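/- Let $k$ be a field of characteristic zero and let $m\ge 2$, $\alpha\ge 1$ and $n\ge 2$ be integers. Let $R_n=k[x_1,\dots,x_n]$ and let $d_n$ be the $k$-derivation $$d_n=(1-x_1x_2^{\alpha})\,\partial_{x_1}+x_1^{m}\,\partial_{x_2}+x_2\,\partial_{x_3}+\dots+x_{n-1}\,\partial_{x_n}$$ of $R_n$ (so $d_n(x_1)=1-x_1x_2^{\alpha}$, $d_n(x_2)=x_1^m$, and $d_n(x_i)=x_{i-1}$ for $3\le i\le n$). Then $d_n$ is simple, that is, $R_n$ has no ideal $I$ with $I\ne 0$, $I\neq R_n$ and $d_n(I)\subseteq I$; and the image $d_n(R_n)$ contains no unit of $R_n$. -/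

import Mathlib

open MvPolynomial

/-- A `k`-derivation `d` of `R` is simple if `R` has no proper non-zero ideal `I`
with `d(I) ⊆ I`. -/
def IsSimpleDerivation {k R : Type*} [CommRing k] [CommRing R] [Algebra k R]
    (d : Derivation k R R) : Prop :=
  ¬ ∃ I : Ideal R, I ≠ ⊥ ∧ I ≠ ⊤ ∧ ∀ r ∈ I, d r ∈ I

/-- The coefficient of `∂/∂x_{i+1}` in `d_n`. The variable `x_j` is `X ⟨j - 1, _⟩`, so
the coefficients are `1 - x_1 x_2 ^ α`, `x_1 ^ m`, `x_2`, …, `x_{n-1}`. -/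
noncomputable def dnCoeff (k : Type*) [Field k] (m α n : ℕ) (hn : 2 ≤ n) (i : Fin n) :
    MvPolynomial (Fin n) k :=
  if i.val = 0 then 1 - X ⟨0, by omega⟩ * X ⟨1, by omega⟩ ^ α
  else if i.val = 1 then X ⟨0, by omega⟩ ^ m
  else X ⟨i.val - 1, by omega⟩

/-- The derivation
`d_n = (1 - x_1 x_2 ^ α) ∂_{x_1} + x_1 ^ m ∂_{x_2} + x_2 ∂_{x_3} + ⋯ + x_{n-1} ∂_{x_n}`
of `k[x_1, …, x_n]`. -/
noncomputable def dn (k : Type*) [Field k] (m α n : ℕ) (hn : 2 ≤ n) :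
    Derivation k (MvPolynomial (Fin n) k) (MvPolynomial (Fin n) k) :=
  ∑ i : Fin n, dnCoeff k m α n hn i • pderiv i

/-!
The proof is an induction on the number of variables. Let `d` be a derivation of a `k`-algebra `R`
and `t ∈ R`, and extend `d` to `R[X]` by `X ↦ t`. If `d` is simple, its constants are `k`, and no
nonzero element of `k + k t` is in its image, then the extension has the same three properties, with
`X` in the place of `t` (`IsExtensible.extend`): simplicity is Shamsuddin's criterion, and the other
two follow by comparing coefficients of powers of `X`. Since a unit of `k[x₁, …, xₙ]` is a nonzero
constant, the theorem follows from the case of the plane derivation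
`d = (1 - x y ^ α) ∂/∂x + x ^ m ∂/∂y` of `k[y][x]`, with `t = y`.

For the plane, `d f ∈ k[y]` implies that `f` is constant, and `d f = - y ^ α f` implies `f = 0`;
both are the statement `eq_zero_of_coeff_recurrence` on the coefficients, where a positivity argument on
the two highest weighted layers of `f` rules out a solution.

Simplicity in the plane is reduced to Darboux polynomials, that is, to `f` with `d f = l f`. An
invariant ideal `I ≠ 0` that meets `k[y]` nontrivially contains a power of `x`, and so `1`; one
that meets `k[y]` only in `0` yields a Darboux polynomial of positive `x`-degree, the primitive part
of an element of least `x`-degree (`exists_darboux_of_invariant`).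

To exclude these, let `ξ = y ^ (-α) (1 + ⋯) ∈ k((1/y))` be the formal solution of the trajectory
equation `1 - x y ^ α = x ^ m dx/dy`. Evaluation at `x = ξ` turns `d` into `ξ ^ m d/dy`, which
lowers the degree in `y` by at least `α m + 1`. If `f (ξ) ≠ 0`, the cofactor `l` becomes
`ξ ^ m (f (ξ))' / f (ξ)`, of degree at most `- α m - 1`; if `f` vanishes to first order at `ξ`, the
same holds for `l + y ^ α`. On the other hand `l` has weighted degree at most `m α`
(`cofactor_weight_le`), and its monomials have distinct degrees greater than `- α m - 1` at `ξ`,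
so `l = 0` or `l = - y ^ α`. The latter case shows that no nonzero polynomial vanishes at `ξ`
(`evalAtInfinity_injective`); hence only `l = 0` remains, and `f` would be constant.
-/

/-! ### Uniqueness for the coefficient recurrence -/

/-- Let `c i j` be the coefficients of a polynomial `f`. For `p = 0` the recurrence says that
`d f ∈ k[y]`, and for `p = 1` that `d f = - y ^ a f`, where `d = (1 - x y ^ a) ∂/∂x + x ^ m ∂/∂y`;
the conclusion is that `f` is constant, respectively zero.

Give `x` the weight `a + 1` and `y` the weight `m`. The top part of `d` is `- x y ^ a ∂/∂x +
x ^ m ∂/∂y`, which forces the form of top weight of `f` to be a multiple of `x ^ p H ^ s`, with `H` a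
combination of `x ^ m` and `y ^ (a + 1)`. The part of `f` one step of `∂/∂x` further down solves a
triangular system whose right-hand side consists of positive multiples of the leading coefficient,
and positivity propagates up to an entry that has a negative exponent of `y`. -/
lemma eq_zero_of_coeff_recurrence {k : Type*} [Field k] [CharZero k] {m a p : ℤ}
    (hm : 2 ≤ m) (ha : 1 ≤ a) (hp : p = 0 ∨ p = 1) (c : ℤ → ℤ → k)
    (hneg : ∀ i j : ℤ, i < 0 ∨ j < 0 → c i j = 0)
    (hbdd : ∃ B : ℤ, ∀ i j : ℤ, c i j ≠ 0 → (a + 1) * i + m * j ≤ B)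
    (hrec : ∀ i j : ℤ, 1 ≤ i ∨ p = 1 →
      (i + 1 : k) * c (i + 1) j + (p - i : k) * c i (j - a) + (j + 1 : k) * c (i - m) (j + 1) = 0)
    (i j : ℤ) (hij : p = 1 ∨ 0 < i ∨ 0 < j) : c i j = 0 := by
  by_contra hc
  have hnn : ∀ i j : ℤ, c i j ≠ 0 → 0 ≤ i ∧ 0 ≤ j := fun i j h =>
    ⟨not_lt.1 fun h' => h (hneg i j (Or.inl h')), not_lt.1 fun h' => h (hneg i j (Or.inr h'))⟩
  obtain ⟨B, hB⟩ := hbdd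
  obtain ⟨W, ⟨i₀, j₀, hij₀, hc₀, hW₀⟩, hWmax⟩ := Int.exists_greatest_of_bdd
    (P := fun W => ∃ i j, (p = 1 ∨ 0 < i ∨ 0 < j) ∧ c i j ≠ 0 ∧ (a + 1) * i + m * j = W)
    ⟨B, by rintro z ⟨i, j, _, h, rfl⟩; exact hB i j h⟩ ⟨_, i, j, hij, hc, rfl⟩
  obtain ⟨hi₀, hj₀⟩ := hnn _ _ hc₀
  have hWnn : 0 ≤ W := by rw [← hW₀]; positivity
  have hWpos : p = 0 → 0 < W := by
    intro h0
    rcases hij₀ with h | h | h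
    · omega
    · rw [← hW₀]; positivity
    · rw [← hW₀]; positivity
  -- no coefficient lives above weight `W`; `0 ≤ W` takes care of the index `(0, 0)`
  have hvan : ∀ i j : ℤ, W < (a + 1) * i + m * j → c i j = 0 := by
    intro i j h
    by_contra h'
    obtain ⟨hi, hj⟩ := hnn _ _ h'
    by_cases hd : p = 1 ∨ 0 < i ∨ 0 < j
    · exact absurd (hWmax _ ⟨i, j, hd, h', rfl⟩) (not_le.2 h)
    · push Not at hd
      obtain rfl : i = 0 := by omega
      obtain rfl : j = 0 := by omega
      simp only [mul_zero, add_zero] at h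
      omega
  have htop : ∀ i j : ℤ, (a + 1) * i + m * j = W →
      (i - p : k) * c i j = (j + a + 1 : k) * c (i - m) (j + a + 1) := by
    intro i j h
    by_cases hd : 1 ≤ i ∨ p = 1
    · have h1 := hrec i (j + a) hd
      rw [hvan (i + 1) (j + a) (by nlinarith), add_sub_cancel_right] at h1
      push_cast at h1
      linear_combination -h1
    · push Not at hd
      obtain rfl : p = 0 := by omega
      rw [hneg (i - m) _ (Or.inl (by omega)), mul_zero]
      rcases (show i = 0 ∨ i < 0 by omega) with rfl | h'
      · simp
      · rw [hneg i j (Or.inl h'), mul_zero]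
  -- the step `(i, j) ↦ (i - m, j + a + 1)` along the top form preserves nonvanishing until `i = p`
  have hdesc : ∀ n : ℕ, ∀ i j : ℤ, i < n → (a + 1) * i + m * j = W → c i j ≠ 0 →
      ∃ J, c p J ≠ 0 ∧ (a + 1) * p + m * J = W := by
    intro n
    induction n with
    | zero => intro i j h _ h'; exact absurd (hneg i j (Or.inl (by exact_mod_cast h))) h'
    | succ n ih =>
      intro i j h hw h'
      by_cases hip : i = p
      · subst hip; exact ⟨j, h', hw⟩
      · have h1 := htop i j hw
        have h2 : (i - p : k) ≠ 0 := by rw [sub_ne_zero]; exact_mod_cast hip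
        refine ih (i - m) (j + a + 1) (by push_cast at h; omega) (by rw [← hw]; ring) ?_
        intro h3
        rw [h3, mul_zero] at h1
        exact (mul_ne_zero h2 h') h1
  obtain ⟨J, hJ, hJW⟩ := hdesc (i₀.toNat + 1) i₀ j₀ (by omega) hW₀ hc₀
  obtain ⟨-, hJnn⟩ := hnn _ _ hJ
  have hJpos : p = 0 → 0 < J := by
    intro h; have := hWpos h; rw [← hJW, h] at this
    simp only [mul_zero, zero_add] at this
    exact (pos_iff_pos_of_mul_pos this).1 (by omega)
  -- positive rational multiples of the coefficient `c p J`
  let Pos : k → Prop := fun x => ∃ q : ℚ, 0 < q ∧ x = q * c p J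
  have pos_ne : ∀ x, Pos x → x ≠ 0 := by
    rintro x ⟨q, hq, rfl⟩
    exact mul_ne_zero (by exact_mod_cast hq.ne') hJ
  have pos_add : ∀ x y, Pos x → Pos y → Pos (x + y) := by
    rintro x y ⟨q, hq, rfl⟩ ⟨r, hr, rfl⟩
    exact ⟨q + r, by positivity, by push_cast; ring⟩
  have pos_mul : ∀ (n : ℤ) x, 0 < n → Pos x → Pos (n * x) := by
    rintro n x hn ⟨q, hq, rfl⟩
    exact ⟨n * q, by positivity, by push_cast; ring⟩
  have pos_div : ∀ (n : ℤ) x, 0 < n → Pos (n * x) → Pos x := by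
    rintro n x hn ⟨q, hq, h⟩
    have : (n : k) ≠ 0 := by exact_mod_cast hn.ne'
    refine ⟨q / n, by positivity, ?_⟩
    push_cast
    field_simp
    linear_combination h
  have hw : ∀ t : ℤ, (a + 1) * (p + m * t) + m * (J - (a + 1) * t) = W := by
    intro t; rw [← hJW]; ring
  have hstep : ∀ t : ℤ, ((m * (t + 1) : ℤ) : k) * c (p + m * (t + 1)) (J - (a + 1) * (t + 1)) =
      ((J - (a + 1) * t : ℤ) : k) * c (p + m * t) (J - (a + 1) * t) := by
    intro t
    have h := htop _ _ (hw (t + 1))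
    rw [show p + m * (t + 1) - m = p + m * t by ring,
      show J - (a + 1) * (t + 1) + a + 1 = J - (a + 1) * t by ring] at h
    push_cast at h ⊢
    linear_combination h
  have hF : ∀ t : ℕ, (a + 1) * t ≤ J → Pos (c (p + m * t) (J - (a + 1) * t)) := by
    intro t
    induction t with
    | zero => intro _; exact ⟨1, one_pos, by simp⟩
    | succ t ih =>
      intro ht
      push_cast at ht ⊢
      refine pos_div (m * (t + 1)) _ (by positivity) ?_
      rw [hstep t]
      exact pos_mul _ _ (by nlinarith) (ih (by nlinarith))
  -- the top form ends at an exponent of `y` that is zero, since otherwise it could be continued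
  -- to a negative exponent; so `J` is a multiple of `a + 1`
  obtain ⟨s, hs⟩ : ∃ s : ℕ, J = (a + 1) * s := by
    refine ⟨(J / (a + 1)).toNat, ?_⟩
    have h0 : 0 ≤ J / (a + 1) := Int.ediv_nonneg hJnn (by omega)
    have h1 := Int.mul_ediv_add_emod J (a + 1)
    have h2 := Int.emod_nonneg J (show a + 1 ≠ 0 by omega)
    have h3 := Int.emod_lt_of_pos J (show 0 < a + 1 by omega)
    have h4 := hstep (J / (a + 1)).toNat
    have h5 := hF (J / (a + 1)).toNat (by rw [Int.toNat_of_nonneg h0]; omega)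
    rw [Int.toNat_of_nonneg h0] at h4 h5 ⊢
    rw [hneg _ (J - (a + 1) * (J / (a + 1) + 1)) (Or.inr (by rw [mul_add]; omega)), mul_zero] at h4
    have h6 := (mul_eq_zero.1 h4.symm).resolve_right (pos_ne _ h5)
    have h7 : J - (a + 1) * (J / (a + 1)) = 0 := by exact_mod_cast h6
    omega
  -- the recurrence one step of `∂/∂x` below the top form
  have hstep2 : ∀ t : ℤ, ((1 : ℤ) ≤ p + m * t - 1 ∨ p = 1) →
      ((m * t - 1 : ℤ) : k) * c (p + m * t - 1) (J - (a + 1) * t - a) =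
      ((p + m * t : ℤ) : k) * c (p + m * t) (J - (a + 1) * t) +
      ((J - (a + 1) * t + 1 : ℤ) : k) *
        c (p + m * (t - 1) - 1) (J - (a + 1) * (t - 1) - a) := by
    intro t ht
    have h := hrec (p + m * t - 1) (J - (a + 1) * t) ht
    rw [show p + m * t - 1 + 1 = p + m * t by ring,
      show p + m * t - 1 - m = p + m * (t - 1) - 1 by ring,
      show J - (a + 1) * t + 1 = J - (a + 1) * (t - 1) - a by ring] at h
    rw [show J - (a + 1) * t + 1 = J - (a + 1) * (t - 1) - a by ring]
    push_cast at h ⊢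
    linear_combination -h
  have hphi0 : c (p - 1) (J - a) = - p * c p J := by
    rcases hp with rfl | rfl
    · rw [hneg _ _ (Or.inl (by omega))]; simp
    · have h := hstep2 0 (Or.inr rfl)
      rw [hneg (1 + m * (0 - 1) - 1) _ (Or.inl (by omega))] at h
      simp only [mul_zero, add_zero, sub_zero, zero_sub] at h ⊢
      push_cast at h ⊢
      linear_combination -h
  have hphi : ∀ t : ℕ, (a + 1) * (t + 1) ≤ J →
      Pos (c (p + m * (t + 1) - 1) (J - (a + 1) * (t + 1) - a)) := by
    intro t
    induction t with
    | zero =>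
      intro ht
      have h := hstep2 1 (by omega)
      have h' := hstep 0
      simp only [sub_self, mul_zero, add_zero, sub_zero, mul_one, zero_add, hphi0] at h h'
      push_cast at ht h h' ⊢
      simp only [mul_one] at ht ⊢
      refine pos_div (m * (m - 1)) _ (mul_pos (by omega) (by omega)) ?_
      -- for `p = 1` the negative start `- c p J` is outweighed by the contribution of the top form
      rcases hp with rfl | rfl
      · refine ⟨m * J, ?_, ?_⟩
        · have : 0 < m * J := mul_pos (by omega) (by omega)
          exact_mod_cast this
        · push_cast at h h' ⊢
          linear_combination m * h + m * h'
      · refine ⟨J + m * a, ?_, ?_⟩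
        · have : 0 < J + m * a := by positivity
          exact_mod_cast this
        · push_cast at h h' ⊢
          linear_combination m * h + (1 + m) * h'
    | succ t ih =>
      intro ht
      push_cast at ht ⊢
      have hmt : 2 ≤ m * (t + 1 + 1 : ℤ) := by nlinarith
      have h := hstep2 (t + 1 + 1) (by omega)
      rw [show (t + 1 + 1 - 1 : ℤ) = t + 1 by ring] at h
      refine pos_div (m * (t + 1 + 1) - 1) _ (by omega) ?_
      rw [h]
      have hF' := hF (t + 2) (by push_cast; linarith)
      push_cast at hF'
      rw [show (t + 2 : ℤ) = t + 1 + 1 by ring] at hF'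
      refine pos_add _ _ (pos_mul _ _ (by omega) hF') (pos_mul _ _ (by omega) (ih ?_))
      nlinarith
  rcases s with _ | s
  · rcases hp with rfl | rfl
    · have := hJpos rfl; simp at hs; omega
    · rw [hneg _ (J - a) (Or.inr (by simp at hs; omega))] at hphi0
      simp [hJ] at hphi0
  -- the last entry is a nonzero coefficient at the exponent `- a` of `y`
  · push_cast at hs
    refine pos_ne _ (hphi s hs.ge) (hneg _ _ (Or.inr ?_))
    rw [hs]; omega

/-! ### The plane derivation and its coefficients -/

/-- The derivation of `A[X]` that applies the derivation `d` of `A` to each coefficient and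
kills `X`. -/
noncomputable def coeffDerivation {k A : Type*} [CommRing k] [CommRing A] [Algebra k A]
    (d : Derivation k A A) : Derivation k (Polynomial A) (Polynomial A) :=
  Derivation.mk' ((PolynomialModule.equivPolynomialSelf (R := A)).toLinearMap.restrictScalars k ∘ₗ
    d.mapCoeffs.toLinearMap) fun a b => by
      change PolynomialModule.equivPolynomialSelf (R := A) (d.mapCoeffs (a * b)) =
        a • PolynomialModule.equivPolynomialSelf (R := A) (d.mapCoeffs b) +
          b • PolynomialModule.equivPolynomialSelf (R := A) (d.mapCoeffs a)
      rw [Derivation.leibniz, map_add, map_smul, map_smul]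

lemma coeff_coeffDerivation {k A : Type*} [CommRing k] [CommRing A] [Algebra k A]
    (d : Derivation k A A) (f : Polynomial A) (i : ℕ) :
    (coeffDerivation d f).coeff i = d (f.coeff i) := rfl

lemma coeffDerivation_C {k A : Type*} [CommRing k] [CommRing A] [Algebra k A]
    (d : Derivation k A A) (a : A) :
    coeffDerivation d (Polynomial.C a) = Polynomial.C (d a) := by
  ext i
  rw [coeff_coeffDerivation, Polynomial.coeff_C, Polynomial.coeff_C]
  split_ifs <;> simp

lemma coeffDerivation_X {k A : Type*} [CommRing k] [CommRing A] [Algebra k A]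
    (d : Derivation k A A) : coeffDerivation d Polynomial.X = 0 := by
  ext i
  rw [coeff_coeffDerivation, Polynomial.coeff_X]
  split_ifs <;> simp

lemma derivative_coeffDerivation {k A : Type*} [CommRing k] [CommRing A] [Algebra k A]
    (d : Derivation k A A) (f : Polynomial A) :
    Polynomial.derivative (coeffDerivation d f) = coeffDerivation d (Polynomial.derivative f) := by
  ext i
  rw [coeff_coeffDerivation, Polynomial.coeff_derivative, Polynomial.coeff_derivative,
    coeff_coeffDerivation, ← Nat.cast_succ, mul_comm, mul_comm (f.coeff _), ← nsmul_eq_mul,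
    ← nsmul_eq_mul, map_nsmul]

/-- The derivation `u • d + v • d/dX` of `A[X]`, where `d` acts on the coefficients. -/
noncomputable def polyDerivation {k A : Type*} [CommRing k] [CommRing A] [Algebra k A]
    (u : Polynomial A) (d : Derivation k A A) (v : Polynomial A) :
    Derivation k (Polynomial A) (Polynomial A) :=
  u • coeffDerivation d + v • (Polynomial.derivative' (R := A)).restrictScalars k

lemma polyDerivation_apply {k A : Type*} [CommRing k] [CommRing A] [Algebra k A]
    (u : Polynomial A) (d : Derivation k A A) (v f : Polynomial A) :
    polyDerivation u d v f = u * coeffDerivation d f + v * Polynomial.derivative f := rfl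

/-- Differentiation of the coefficients of a polynomial in `k[y][x]`, that is, `∂/∂y`. -/
noncomputable abbrev derivY {k : Type*} [Field k] :
    Derivation k (Polynomial (Polynomial k)) (Polynomial (Polynomial k)) :=
  coeffDerivation Polynomial.derivative'

/-- The derivation `(1 - x y ^ α) ∂/∂x + x ^ m ∂/∂y` of `k[y][x]`: the outer variable is `x`. -/
noncomputable def planeDerivation (k : Type*) [Field k] (m α : ℕ) :
    Derivation k (Polynomial (Polynomial k)) (Polynomial (Polynomial k)) :=
  polyDerivation (Polynomial.X ^ m) Polynomial.derivative'
    (1 - Polynomial.X * Polynomial.C (Polynomial.X ^ α))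

lemma planeDerivation_apply {k : Type*} [Field k] (m α : ℕ) (f : Polynomial (Polynomial k)) :
    planeDerivation k m α f = Polynomial.X ^ m * derivY f +
      (1 - Polynomial.X * Polynomial.C (Polynomial.X ^ α)) * Polynomial.derivative f := rfl

/-- The coefficient of `x ^ i y ^ j` in a polynomial of `k[y][x]`, with integer exponents, so that
it vanishes when one of them is negative. -/
noncomputable def intCoeff {k : Type*} [Field k] (f : Polynomial (Polynomial k)) (i j : ℤ) : k :=
  if 0 ≤ i ∧ 0 ≤ j then (f.coeff i.toNat).coeff j.toNat else 0

lemma intCoeff_natCast {k : Type*} [Field k] (f : Polynomial (Polynomial k)) (i j : ℕ) :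
    intCoeff f i j = (f.coeff i).coeff j := by simp [intCoeff]

lemma intCoeff_of_neg {k : Type*} [Field k] (f : Polynomial (Polynomial k)) {i j : ℤ}
    (h : i < 0 ∨ j < 0) : intCoeff f i j = 0 := if_neg (by omega)

lemma intCoeff_add {k : Type*} [Field k] (f g : Polynomial (Polynomial k)) (i j : ℤ) :
    intCoeff (f + g) i j = intCoeff f i j + intCoeff g i j := by
  unfold intCoeff; split_ifs <;> simp

lemma intCoeff_neg {k : Type*} [Field k] (f : Polynomial (Polynomial k)) (i j : ℤ) :
    intCoeff (-f) i j = -intCoeff f i j := by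
  unfold intCoeff; split_ifs <;> simp

lemma intCoeff_derivative {k : Type*} [Field k] (f : Polynomial (Polynomial k)) (i j : ℤ) :
    intCoeff (Polynomial.derivative f) i j = (i + 1) * intCoeff f (i + 1) j := by
  rcases lt_or_ge j 0 with hj | hj
  · rw [intCoeff_of_neg _ (Or.inr hj), intCoeff_of_neg _ (Or.inr hj), mul_zero]
  lift j to ℕ using hj
  rcases lt_or_ge i 0 with hi | hi
  · rw [intCoeff_of_neg _ (Or.inl hi)]
    rcases (show i = -1 ∨ i + 1 < 0 by omega) with rfl | h
    · simp
    · rw [intCoeff_of_neg _ (Or.inl h), mul_zero]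
  lift i to ℕ using hi
  have : ((i : ℤ) + 1) = ((i + 1 : ℕ) : ℤ) := by push_cast; rfl
  rw [this, intCoeff_natCast, intCoeff_natCast, Polynomial.coeff_derivative, ← Nat.cast_succ,
    mul_comm, ← nsmul_eq_mul, Polynomial.coeff_smul, nsmul_eq_mul]
  push_cast
  rfl

lemma intCoeff_derivY {k : Type*} [Field k] (f : Polynomial (Polynomial k)) (i j : ℤ) :
    intCoeff (derivY f) i j = (j + 1) * intCoeff f i (j + 1) := by
  rcases lt_or_ge i 0 with hi | hi
  · rw [intCoeff_of_neg _ (Or.inl hi), intCoeff_of_neg _ (Or.inl hi), mul_zero]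
  lift i to ℕ using hi
  rcases lt_or_ge j 0 with hj | hj
  · rw [intCoeff_of_neg _ (Or.inr hj)]
    rcases (show j = -1 ∨ j + 1 < 0 by omega) with rfl | h
    · simp
    · rw [intCoeff_of_neg _ (Or.inr h), mul_zero]
  lift j to ℕ using hj
  have : ((j : ℤ) + 1) = ((j + 1 : ℕ) : ℤ) := by push_cast; rfl
  rw [this, intCoeff_natCast, intCoeff_natCast, coeff_coeffDerivation]
  change (Polynomial.derivative (f.coeff i)).coeff j = _
  rw [Polynomial.coeff_derivative, mul_comm]
  push_cast
  rfl

lemma intCoeff_X_pow_mul {k : Type*} [Field k] (f : Polynomial (Polynomial k)) (n : ℕ) (i j : ℤ) :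
    intCoeff (Polynomial.X ^ n * f) i j = intCoeff f (i - n) j := by
  rcases lt_or_ge j 0 with hj | hj
  · rw [intCoeff_of_neg _ (Or.inr hj), intCoeff_of_neg _ (Or.inr hj)]
  lift j to ℕ using hj
  rcases lt_or_ge i 0 with hi | hi
  · rw [intCoeff_of_neg _ (Or.inl hi), intCoeff_of_neg _ (Or.inl (by omega))]
  lift i to ℕ using hi
  rw [intCoeff_natCast, Polynomial.coeff_X_pow_mul']
  split_ifs with h
  · rw [← Nat.cast_sub h, intCoeff_natCast]
  · rw [intCoeff_of_neg _ (Or.inl (by omega)), Polynomial.coeff_zero]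

lemma intCoeff_C_X_pow_mul {k : Type*} [Field k] (f : Polynomial (Polynomial k)) (n : ℕ)
    (i j : ℤ) :
    intCoeff (Polynomial.C (Polynomial.X ^ n) * f) i j = intCoeff f i (j - n) := by
  rcases lt_or_ge i 0 with hi | hi
  · rw [intCoeff_of_neg _ (Or.inl hi), intCoeff_of_neg _ (Or.inl hi)]
  lift i to ℕ using hi
  rcases lt_or_ge j 0 with hj | hj
  · rw [intCoeff_of_neg _ (Or.inr hj), intCoeff_of_neg _ (Or.inr (by omega))]
  lift j to ℕ using hj
  rw [intCoeff_natCast, Polynomial.coeff_C_mul, Polynomial.coeff_X_pow_mul']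
  split_ifs with h
  · rw [← Nat.cast_sub h, intCoeff_natCast]
  · rw [intCoeff_of_neg _ (Or.inr (by omega))]

lemma intCoeff_planeDerivation {k : Type*} [Field k] (m α : ℕ) (f : Polynomial (Polynomial k))
    (i j : ℤ) :
    intCoeff (planeDerivation k m α f) i j =
      (i + 1) * intCoeff f (i + 1) j - i * intCoeff f i (j - α) +
        (j + 1) * intCoeff f (i - m) (j + 1) := by
  have : planeDerivation k m α f = Polynomial.X ^ m * derivY f + (Polynomial.derivative f +
      -(Polynomial.X ^ 1 * (Polynomial.C (Polynomial.X ^ α) * Polynomial.derivative f))) := by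
    rw [planeDerivation_apply]; ring
  rw [this, intCoeff_add, intCoeff_add, intCoeff_neg, intCoeff_X_pow_mul, intCoeff_X_pow_mul,
    intCoeff_C_X_pow_mul, intCoeff_derivY, intCoeff_derivative, intCoeff_derivative]
  push_cast
  rw [sub_add_cancel, sub_add_cancel]
  ring

lemma exists_weight_bound {k : Type*} [Field k] (f : Polynomial (Polynomial k)) (a m : ℤ) :
    ∃ B : ℤ, ∀ i j : ℤ, intCoeff f i j ≠ 0 → a * i + m * j ≤ B := by
  let S : Finset (ℕ × ℕ) := f.support.biUnion fun i => (f.coeff i).support.image fun j => (i, j)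
  obtain ⟨B, hB⟩ := (S.image fun q => a * (q.1 : ℤ) + m * (q.2 : ℤ)).bddAbove
  refine ⟨B, fun i j h => ?_⟩
  have hi : 0 ≤ i := not_lt.1 fun h' => h (intCoeff_of_neg _ (Or.inl h'))
  have hj : 0 ≤ j := not_lt.1 fun h' => h (intCoeff_of_neg _ (Or.inr h'))
  lift i to ℕ using hi
  lift j to ℕ using hj
  rw [intCoeff_natCast] at h
  apply hB
  rw [Finset.coe_image]
  refine ⟨(i, j), ?_, rfl⟩
  simp only [S, Finset.coe_biUnion, Set.mem_iUnion, Finset.coe_image, Finset.mem_coe,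
    Polynomial.mem_support_iff]
  refine ⟨i, fun h' => h (by rw [h', Polynomial.coeff_zero]), j, ?_, rfl⟩
  simpa using h

/-- A polynomial whose image under the plane derivation lies in `k[y]` is constant. In particular
the constants are `k`, and no nonzero `a + b y` is in the image. -/
lemma eq_const_of_planeDerivation_eq_C {k : Type*} [Field k] [CharZero k] {m α : ℕ}
    (hm : 2 ≤ m) (hα : 1 ≤ α) {f : Polynomial (Polynomial k)} {g : Polynomial k}
    (h : planeDerivation k m α f = Polynomial.C g) :
    ∃ c : k, f = Polynomial.C (Polynomial.C c) := by
  refine ⟨(f.coeff 0).coeff 0, ?_⟩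
  have key := eq_zero_of_coeff_recurrence (k := k) (m := m) (a := α) (p := 0) (by exact_mod_cast hm)
    (by exact_mod_cast hα) (Or.inl rfl) (intCoeff f) (fun _ _ => intCoeff_of_neg f)
    (exists_weight_bound f _ _) ?_
  · ext i j
    rw [Polynomial.coeff_C]
    by_cases h0 : 0 < (i : ℤ) ∨ 0 < (j : ℤ)
    · have := key i j (Or.inr h0)
      rw [intCoeff_natCast] at this
      rw [this]
      split_ifs
      · rw [Polynomial.coeff_C, if_neg (by omega)]
      · simp
    · obtain rfl : i = 0 := by omega
      obtain rfl : j = 0 := by omega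
      simp
  · intro i j hi
    have h1 := intCoeff_planeDerivation m α f i j
    have h2 : intCoeff (Polynomial.C g) i j = 0 := by
      unfold intCoeff
      split_ifs
      · rw [Polynomial.coeff_C, if_neg (by omega), Polynomial.coeff_zero]
      · rfl
    rw [h, h2] at h1
    push_cast
    linear_combination -h1

/-- There is no Darboux polynomial with cofactor `- y ^ α`. -/
lemma eq_zero_of_planeDerivation_eq_neg {k : Type*} [Field k] [CharZero k] {m α : ℕ}
    (hm : 2 ≤ m) (hα : 1 ≤ α) {f : Polynomial (Polynomial k)}
    (h : planeDerivation k m α f = -(Polynomial.C (Polynomial.X ^ α) * f)) : f = 0 := by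
  have key := eq_zero_of_coeff_recurrence (k := k) (m := m) (a := α) (p := 1) (by exact_mod_cast hm)
    (by exact_mod_cast hα) (Or.inr rfl) (intCoeff f) (fun _ _ => intCoeff_of_neg f)
    (exists_weight_bound f _ _) ?_
  · ext i j
    rw [← intCoeff_natCast, key i j (Or.inl rfl)]
    simp
  · intro i j _
    have h1 := intCoeff_planeDerivation m α f i j
    rw [h, intCoeff_neg, intCoeff_C_X_pow_mul] at h1
    push_cast
    linear_combination -h1

/-! ### Weighted degree of cofactors -/

/-- The ring homomorphism `k[y][x] → k[y][x][T]`, `x ↦ x T ^ a`, `y ↦ y T ^ b`, whose `T`-degree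
is the weighted degree with weights `a` and `b`. -/
noncomputable def weightHom (k : Type*) [Field k] (a b : ℕ) :
    Polynomial (Polynomial k) →+* Polynomial (Polynomial (Polynomial k)) :=
  Polynomial.eval₂RingHom
    (Polynomial.eval₂RingHom (Polynomial.C.comp (Polynomial.C.comp Polynomial.C))
      (Polynomial.C (Polynomial.C (Polynomial.X : Polynomial k)) * Polynomial.X ^ b))
    (Polynomial.C (Polynomial.X : Polynomial (Polynomial k)) * Polynomial.X ^ a)

lemma weightHom_monomial {k : Type*} [Field k] (a b i j : ℕ) (c : k) :
    weightHom k a b (Polynomial.monomial i (Polynomial.monomial j c)) =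
      Polynomial.monomial (a * i + b * j)
        (Polynomial.monomial i (Polynomial.monomial j c)) := by
  have h : Polynomial.monomial i (Polynomial.monomial j c) =
      Polynomial.C (Polynomial.C c) * Polynomial.C (Polynomial.X ^ j) * Polynomial.X ^ i := by
    rw [← Polynomial.C_mul, Polynomial.C_mul_X_pow_eq_monomial,
      Polynomial.C_mul_X_pow_eq_monomial]
  rw [← Polynomial.C_mul_X_pow_eq_monomial (n := a * i + b * j), h]
  simp only [weightHom, map_mul, map_pow, Polynomial.coe_eval₂RingHom, Polynomial.eval₂_C,
    Polynomial.eval₂_X, RingHom.comp_apply]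
  ring

lemma coeff_weightHom {k : Type*} [Field k] (a b : ℕ) (f : Polynomial (Polynomial k))
    (n i j : ℕ) :
    (((weightHom k a b f).coeff n).coeff i).coeff j =
      if a * i + b * j = n then (f.coeff i).coeff j else 0 := by
  induction f using Polynomial.induction_on' with
  | add p q hp hq =>
    simp only [map_add, Polynomial.coeff_add, hp, hq]
    split_ifs <;> simp
  | monomial i' p =>
    induction p using Polynomial.induction_on' with
    | add p q hp hq =>
      simp only [map_add, Polynomial.coeff_add, hp, hq]
      split_ifs <;> simp
    | monomial j' c =>
      rw [weightHom_monomial, Polynomial.coeff_monomial, Polynomial.coeff_monomial]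
      by_cases hi : i' = i
      · subst hi
        by_cases hj : j' = j
        · subst hj
          simp only [if_true]
          split_ifs <;> simp
        · rw [if_pos rfl, Polynomial.coeff_monomial, if_neg hj, ite_self]
          split_ifs
          · rw [Polynomial.coeff_monomial, if_pos rfl, Polynomial.coeff_monomial, if_neg hj]
          · simp
      · rw [if_neg hi, Polynomial.coeff_zero, ite_self]
        split_ifs
        · rw [Polynomial.coeff_monomial, if_neg hi, Polynomial.coeff_zero]
        · simp

lemma weightHom_ne_zero {k : Type*} [Field k] (a b : ℕ) {f : Polynomial (Polynomial k)}
    (hf : f ≠ 0) : weightHom k a b f ≠ 0 := by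
  contrapose! hf
  ext i j
  have := coeff_weightHom a b f (a * i + b * j) i j
  rw [hf, if_pos rfl] at this
  rw [← this]
  simp

lemma intCoeff_eq_zero_of_weight_gt {k : Type*} [Field k] {a b : ℕ} {f : Polynomial (Polynomial k)}
    {i j : ℤ} (h : ((weightHom k a b f).natDegree : ℤ) < a * i + b * j) : intCoeff f i j = 0 := by
  rcases lt_or_ge i 0 with hi | hi
  · exact intCoeff_of_neg _ (Or.inl hi)
  rcases lt_or_ge j 0 with hj | hj
  · exact intCoeff_of_neg _ (Or.inr hj)
  lift i to ℕ using hi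
  lift j to ℕ using hj
  have := coeff_weightHom a b f (a * i + b * j) i j
  rw [if_pos rfl, Polynomial.coeff_eq_zero_of_natDegree_lt
    (p := weightHom k a b f) (by exact_mod_cast h)] at this
  rw [intCoeff_natCast, ← this]
  simp

/-- With the weights `α + 1` of `x` and `m` of `y`, the derivation raises weighted degrees by at
most `m α`; this bounds the weighted degree of the cofactor of a Darboux polynomial. -/
lemma cofactor_weight_le {k : Type*} [Field k] {m α : ℕ} {f l : Polynomial (Polynomial k)}
    (hf : f ≠ 0) (h : planeDerivation k m α f = l * f) {i j : ℕ}
    (hl : (l.coeff i).coeff j ≠ 0) : (α + 1) * i + m * j ≤ m * α := by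
  set N := (weightHom k (α + 1) m f).natDegree with hN
  have hl0 : l ≠ 0 := by rintro rfl; simp at hl
  have hdeg : (weightHom k (α + 1) m (planeDerivation k m α f)).natDegree ≤ N + m * α := by
    rw [Polynomial.natDegree_le_iff_coeff_eq_zero]
    intro n hn
    ext i j
    rw [coeff_weightHom]
    split_ifs with hw
    · have hw' : ((α : ℤ) + 1) * i + m * j = n := by exact_mod_cast hw
      have hn' : (N : ℤ) + m * α < n := by exact_mod_cast hn
      have hz : ∀ i' j' : ℤ, (N : ℤ) < (α + 1) * i' + m * j' → intCoeff f i' j' = 0 :=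
        fun i' j' h' => intCoeff_eq_zero_of_weight_gt (a := α + 1) (b := m) (by push_cast; exact h')
      have hmα : (0 : ℤ) ≤ m * α := by positivity
      rw [← intCoeff_natCast, intCoeff_planeDerivation, hz (i + 1) j (by linarith),
        hz i (j - α) (by linarith), hz (i - m) (j + 1) (by linarith)]
      simp
    · simp
  rw [h, map_mul, Polynomial.natDegree_mul (weightHom_ne_zero _ _ hl0) (weightHom_ne_zero _ _ hf),
    ← hN] at hdeg
  refine le_trans ?_ (show (weightHom k (α + 1) m l).natDegree ≤ m * α by omega)
  apply Polynomial.le_natDegree_of_ne_zero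
  intro h0
  have := coeff_weightHom (α + 1) m l ((α + 1) * i + m * j) i j
  rw [h0, if_pos rfl] at this
  exact hl (by rw [← this]; simp)

/-! ### The formal trajectory at infinity -/

/-- A map of `k⟦X⟧` that is contracting for the `X`-adic topology has a fixed point. -/
lemma exists_fixedPoint_of_contracting {k : Type*} [Field k] (F : PowerSeries k → PowerSeries k)
    (hF : ∀ n a b, PowerSeries.X ^ n ∣ a - b → PowerSeries.X ^ (n + 1) ∣ F a - F b) :
    ∃ a, F a = a := by
  have h1 : ∀ n, PowerSeries.X ^ n ∣ F^[n + 1] 0 - F^[n] 0 := by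
    intro n
    induction n with
    | zero => simp
    | succ n ih =>
      have := hF _ _ _ ih
      rwa [← Function.iterate_succ_apply' F (n + 1), ← Function.iterate_succ_apply' F n] at this
  have h2 : ∀ n r, PowerSeries.X ^ n ∣ F^[n + r] 0 - F^[n] 0 := by
    intro n r
    induction r with
    | zero => simp
    | succ r ih =>
      have := dvd_add ((pow_dvd_pow PowerSeries.X (Nat.le_add_right n r)).trans (h1 (n + r))) ih
      rwa [sub_add_sub_cancel] at this
  let a : PowerSeries k := PowerSeries.mk fun i => PowerSeries.coeff i (F^[i + 1] 0)
  have h3 : ∀ n, PowerSeries.X ^ n ∣ a - F^[n] 0 := by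
    intro n
    rw [PowerSeries.X_pow_dvd_iff]
    intro i hi
    have h4 := h2 (i + 1) (n - (i + 1))
    rw [Nat.add_sub_cancel' hi, PowerSeries.X_pow_dvd_iff] at h4
    have h5 := h4 i (Nat.lt_succ_self i)
    rw [map_sub, sub_eq_zero] at h5 ⊢
    rw [h5, PowerSeries.coeff_mk]
  refine ⟨a, sub_eq_zero.1 ?_⟩
  ext n
  have h4 := dvd_sub (hF _ _ _ (h3 (n + 1))) (h3 (n + 2))
  rw [Function.iterate_succ_apply' F (n + 1), sub_sub_sub_cancel_right] at h4
  exact PowerSeries.X_pow_dvd_iff.1 h4 n (by omega)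

/-- Substituting `x = z ^ α η` with `z = 1 / y` turns the trajectory equation
`1 - x y ^ α = x ^ m dx/dy` into this fixed point equation for `η`. -/
lemma exists_powerSeries_solution (k : Type*) [Field k] (m α : ℕ) :
    ∃ η : PowerSeries k, PowerSeries.constantCoeff η = 1 ∧
      η = 1 + PowerSeries.X ^ (α * m + α + 1) *
        (η ^ m * ((α : PowerSeries k) * η + PowerSeries.X * PowerSeries.derivative k η)) := by
  obtain ⟨η, hη⟩ := exists_fixedPoint_of_contracting (k := k)
    (fun η => 1 + PowerSeries.X ^ (α * m + α + 1) *
        (η ^ m * ((α : PowerSeries k) * η + PowerSeries.X * PowerSeries.derivative k η))) (by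
    intro n a b h
    have h1 : PowerSeries.X ^ n ∣
        PowerSeries.X * PowerSeries.derivative k a -
          PowerSeries.X * PowerSeries.derivative k b := by
      obtain ⟨c, hc⟩ := h
      rw [← mul_sub, ← map_sub, hc, Derivation.leibniz, Derivation.leibniz_pow]
      refine ⟨PowerSeries.X * PowerSeries.derivative k c + (n : PowerSeries k) * c, ?_⟩
      rcases n with _ | n
      · simp
      · simp only [smul_eq_mul, nsmul_eq_mul, PowerSeries.derivative_X, Nat.add_sub_cancel]
        ring
    have h2 : PowerSeries.X ^ n ∣
        (a ^ m * ((α : PowerSeries k) * a + PowerSeries.X * PowerSeries.derivative k a)) -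
        (b ^ m * ((α : PowerSeries k) * b + PowerSeries.X * PowerSeries.derivative k b)) := by
      have e : (a ^ m * ((α : PowerSeries k) * a + PowerSeries.X * PowerSeries.derivative k a)) -
        (b ^ m * ((α : PowerSeries k) * b + PowerSeries.X * PowerSeries.derivative k b)) =
        (a ^ m - b ^ m) * ((α : PowerSeries k) * a + PowerSeries.X * PowerSeries.derivative k a) +
        b ^ m * ((α : PowerSeries k) * (a - b) +
          (PowerSeries.X * PowerSeries.derivative k a -
            PowerSeries.X * PowerSeries.derivative k b)) := by ring
      rw [e]
      exact dvd_add (((h.trans (sub_dvd_pow_sub_pow a b m))).mul_right _)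
        ((dvd_add (h.mul_left _) h1).mul_left _)
    rw [add_sub_add_left_eq_sub, ← mul_sub, add_comm n 1, pow_add]
    exact mul_dvd_mul (pow_dvd_pow _ (by omega)) h2)
  refine ⟨η, ?_, hη.symm⟩
  rw [← hη]
  simp

/-- The derivation `z d/dz` of the field of Laurent series in `z`. -/
noncomputable def eulerDerivation (k : Type*) [Field k] : LaurentSeries k →+ LaurentSeries k :=
  AddMonoidHom.mk'
    (fun f => HahnSeries.mk (fun n => (n : k) * f.coeff n)
      (f.isPWO_support.mono fun n hn h => hn (by simp [h])))
    fun f g => by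
      ext n
      exact mul_add _ _ _

lemma coeff_eulerDerivation {k : Type*} [Field k] (f : LaurentSeries k) (n : ℤ) :
    (eulerDerivation k f).coeff n = n * f.coeff n := rfl

lemma eulerDerivation_mul {k : Type*} [Field k] (f g : LaurentSeries k) :
    eulerDerivation k (f * g) = f * eulerDerivation k g + g * eulerDerivation k f := by
  have hs : ∀ f : LaurentSeries k, (eulerDerivation k f).support ⊆ f.support :=
    fun f n hn h => hn (by rw [coeff_eulerDerivation, h, mul_zero])
  ext n
  rw [coeff_eulerDerivation, mul_comm g, HahnSeries.coeff_add, HahnSeries.coeff_mul,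
    HahnSeries.coeff_mul_left' f.isPWO_support (hs f),
    HahnSeries.coeff_mul_right' g.isPWO_support (hs g),
    Finset.mul_sum, ← Finset.sum_add_distrib]
  refine Finset.sum_congr rfl fun ij hij => ?_
  rw [coeff_eulerDerivation, coeff_eulerDerivation, ← (Finset.mem_antidiagonal.1 hij).2.2]
  push_cast
  ring

lemma eulerDerivation_single {k : Type*} [Field k] (n : ℤ) (c : k) :
    eulerDerivation k (HahnSeries.single n c) = n * HahnSeries.single n c := by
  ext i
  have h1 : (n : LaurentSeries k) = HahnSeries.C (n : k) := (map_intCast _ _).symm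
  rw [coeff_eulerDerivation, h1, HahnSeries.C_mul_eq_smul, HahnSeries.coeff_smul]
  rcases eq_or_ne i n with rfl | h
  · rw [smul_eq_mul]
  · rw [HahnSeries.coeff_single_of_ne h, mul_zero, smul_zero]

lemma eulerDerivation_coe {k : Type*} [Field k] (f : PowerSeries k) :
    eulerDerivation k (HahnSeries.ofPowerSeries ℤ k f) =
      HahnSeries.ofPowerSeries ℤ k (PowerSeries.X * PowerSeries.derivative k f) := by
  ext i
  rw [coeff_eulerDerivation, PowerSeries.coeff_coe, PowerSeries.coeff_coe]
  split_ifs with h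
  · simp
  · push Not at h
    lift i to ℕ using h
    rcases i with _ | i
    · simp
    · rw [Int.natAbs_natCast, PowerSeries.coeff_succ_X_mul, PowerSeries.coeff_derivative]
      push_cast
      ring

/-- Laurent series in `z = 1 / y`, differentiated with respect to `y`: the derivation
`d/dy = - z ^ 2 d/dz`. -/
noncomputable def derivAtInfinity (k : Type*) [Field k] : LaurentSeries k →+ LaurentSeries k :=
  (AddMonoidHom.mulLeft (-HahnSeries.single (1 : ℤ) (1 : k))).comp (eulerDerivation k)

lemma derivAtInfinity_apply {k : Type*} [Field k] (f : LaurentSeries k) :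
    derivAtInfinity k f = -HahnSeries.single (1 : ℤ) (1 : k) * eulerDerivation k f := rfl

lemma derivAtInfinity_mul {k : Type*} [Field k] (f g : LaurentSeries k) :
    derivAtInfinity k (f * g) = f * derivAtInfinity k g + g * derivAtInfinity k f := by
  simp only [derivAtInfinity_apply, eulerDerivation_mul]
  ring

lemma derivAtInfinity_C {k : Type*} [Field k] (c : k) :
    derivAtInfinity k (HahnSeries.C c) = 0 := by
  rw [derivAtInfinity_apply, HahnSeries.C_apply, eulerDerivation_single]
  simp

lemma derivAtInfinity_y {k : Type*} [Field k] :
    derivAtInfinity k (HahnSeries.single (-1 : ℤ) 1) = 1 := by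
  rw [derivAtInfinity_apply, eulerDerivation_single]
  push_cast
  rw [neg_one_mul, neg_mul_neg, HahnSeries.single_mul_single]
  simp

lemma le_orderTop_derivAtInfinity {k : Type*} [Field k] (f : LaurentSeries k) :
    f.orderTop + 1 ≤ (derivAtInfinity k f).orderTop := by
  have h : f.orderTop ≤ (eulerDerivation k f).orderTop := by
    by_cases h0 : eulerDerivation k f = 0
    · rw [h0]; simp
    · rw [HahnSeries.orderTop_of_ne_zero h0]
      apply HahnSeries.orderTop_le_of_coeff_ne_zero
      intro h
      have := HahnSeries.coeff_orderTop_ne (x := eulerDerivation k f)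
        (HahnSeries.orderTop_of_ne_zero h0)
      rw [coeff_eulerDerivation, h, mul_zero] at this
      exact this rfl
  rw [derivAtInfinity_apply, HahnSeries.orderTop_mul, HahnSeries.orderTop_neg,
    HahnSeries.orderTop_single one_ne_zero, add_comm]
  exact add_le_add_right h _

/-- Near `y = ∞` the equation `1 - x y ^ α = x ^ m dx/dy` of the trajectories has a formal
solution `ξ = y ^ (-α) (1 + ⋯)`. -/
lemma exists_formal_trajectory (k : Type*) [Field k] (m α : ℕ) :
    ∃ (ξ : LaurentSeries k) (η : PowerSeries k),
      ξ = HahnSeries.single (α : ℤ) 1 * HahnSeries.ofPowerSeries ℤ k η ∧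
      PowerSeries.constantCoeff η = 1 ∧
      1 - ξ * HahnSeries.single (-1 : ℤ) 1 ^ α = ξ ^ m * derivAtInfinity k ξ := by
  obtain ⟨η, h1, h2⟩ := exists_powerSeries_solution k m α
  refine ⟨_, η, rfl, h1, ?_⟩
  have h3 := congrArg (HahnSeries.ofPowerSeries ℤ k) h2
  rw [derivAtInfinity_apply, eulerDerivation_mul, eulerDerivation_single, eulerDerivation_coe]
  simp only [map_add, map_mul, map_pow, map_one, map_natCast, HahnSeries.ofPowerSeries_X] at h3 ⊢
  have h4 : HahnSeries.single (α : ℤ) (1 : k) = HahnSeries.single (1 : ℤ) (1 : k) ^ α := by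
    rw [HahnSeries.single_pow]; simp
  have h5 : HahnSeries.single (-1 : ℤ) (1 : k) * HahnSeries.single (1 : ℤ) (1 : k) = 1 := by
    rw [HahnSeries.single_mul_single]; simp
  rw [h4]
  generalize HahnSeries.single (1 : ℤ) (1 : k) = z at *
  generalize HahnSeries.single (-1 : ℤ) (1 : k) = y at *
  generalize HahnSeries.ofPowerSeries ℤ k η = e at *
  generalize HahnSeries.ofPowerSeries ℤ k (PowerSeries.derivative k η) = e' at *
  have h6 : z ^ α * e * y ^ α = e := by
    rw [mul_right_comm, ← mul_pow, mul_comm z y, h5, one_pow, one_mul]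
  rw [h6]
  simp only [Int.cast_natCast]
  linear_combination -h3

/-! ### Evaluation on the formal trajectory -/

/-- The evaluation `k[y][x] → k((1/y))` at `x = ξ`. -/
noncomputable def evalAtInfinity {k : Type*} [Field k] (ξ : LaurentSeries k) :
    Polynomial (Polynomial k) →+* LaurentSeries k :=
  Polynomial.eval₂RingHom
    (Polynomial.eval₂RingHom (HahnSeries.C : k →+* LaurentSeries k)
      (HahnSeries.single (-1 : ℤ) (1 : k))) ξ

lemma evalAtInfinity_X {k : Type*} [Field k] (ξ : LaurentSeries k) :
    evalAtInfinity ξ Polynomial.X = ξ := by simp [evalAtInfinity]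

lemma evalAtInfinity_C_X {k : Type*} [Field k] (ξ : LaurentSeries k) :
    evalAtInfinity ξ (Polynomial.C Polynomial.X) = HahnSeries.single (-1 : ℤ) (1 : k) := by
  simp [evalAtInfinity]

lemma evalAtInfinity_C_C {k : Type*} [Field k] (ξ : LaurentSeries k) (c : k) :
    evalAtInfinity ξ (Polynomial.C (Polynomial.C c)) = HahnSeries.C c := by
  simp [evalAtInfinity]

/-- The chain rule for `y ↦ f (ξ (y), y)`. -/
lemma derivAtInfinity_evalAtInfinity {k : Type*} [Field k] (ξ : LaurentSeries k)
    (f : Polynomial (Polynomial k)) :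
    derivAtInfinity k (evalAtInfinity ξ f) = evalAtInfinity ξ (derivY f) +
      evalAtInfinity ξ (Polynomial.derivative f) * derivAtInfinity k ξ := by
  have hmul : ∀ f g : Polynomial (Polynomial k),
      derivAtInfinity k (evalAtInfinity ξ f) = evalAtInfinity ξ (derivY f) +
        evalAtInfinity ξ (Polynomial.derivative f) * derivAtInfinity k ξ →
      derivAtInfinity k (evalAtInfinity ξ g) = evalAtInfinity ξ (derivY g) +
        evalAtInfinity ξ (Polynomial.derivative g) * derivAtInfinity k ξ →
      derivAtInfinity k (evalAtInfinity ξ (f * g)) = evalAtInfinity ξ (derivY (f * g)) +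
        evalAtInfinity ξ (Polynomial.derivative (f * g)) * derivAtInfinity k ξ := by
    intro f g hf hg
    rw [map_mul, derivAtInfinity_mul, hf, hg, Derivation.leibniz, Polynomial.derivative_mul]
    simp only [map_add, map_mul, smul_eq_mul]
    ring
  have hC : ∀ p : Polynomial k, derivAtInfinity k (evalAtInfinity ξ (Polynomial.C p)) =
      evalAtInfinity ξ (derivY (Polynomial.C p)) +
        evalAtInfinity ξ (Polynomial.derivative (Polynomial.C p)) * derivAtInfinity k ξ := by
    intro p
    induction p using Polynomial.induction_on with
    | C c =>
      rw [evalAtInfinity_C_C, derivAtInfinity_C, coeffDerivation_C]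
      simp
    | add p q hp hq =>
      simp only [map_add, hp, hq]
      ring
    | monomial n c ih =>
      rw [pow_succ, ← mul_assoc, Polynomial.C_mul (b := Polynomial.X)]
      refine hmul _ _ ih ?_
      rw [evalAtInfinity_C_X, derivAtInfinity_y, coeffDerivation_C]
      simp
  induction f using Polynomial.induction_on with
  | C p => exact hC p
  | add p q hp hq =>
    simp only [map_add, hp, hq]
    ring
  | monomial n p ih =>
    rw [pow_succ, ← mul_assoc]
    refine hmul _ _ ih ?_
    rw [evalAtInfinity_X, coeffDerivation_X]
    simp

/-- On a trajectory `ξ`, the plane derivation acts as `ξ ^ m d/dy`; so the kernel of the evaluation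
is an invariant ideal. -/
lemma evalAtInfinity_planeDerivation {k : Type*} [Field k] {m α : ℕ} {ξ : LaurentSeries k}
    (hξ : 1 - ξ * HahnSeries.single (-1 : ℤ) 1 ^ α = ξ ^ m * derivAtInfinity k ξ)
    (f : Polynomial (Polynomial k)) :
    evalAtInfinity ξ (planeDerivation k m α f) =
      ξ ^ m * derivAtInfinity k (evalAtInfinity ξ f) := by
  rw [derivAtInfinity_evalAtInfinity, planeDerivation_apply]
  simp only [map_add, map_mul, map_sub, map_pow, map_one, evalAtInfinity_X, evalAtInfinity_C_X, hξ]
  ring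

/-- The series `ξ ^ i y ^ j` has leading term `y ^ (j - α i)`. -/
lemma coeff_pow_mul_pow {k : Type*} [Field k] {α : ℕ} {ξ : LaurentSeries k} {η : PowerSeries k}
    (h : ξ = HahnSeries.single (α : ℤ) 1 * HahnSeries.ofPowerSeries ℤ k η)
    (hη : PowerSeries.constantCoeff η = 1) (i j : ℕ) (n : ℤ) (hn : n ≤ α * i - j) :
    (ξ ^ i * HahnSeries.single (-1 : ℤ) (1 : k) ^ j).coeff n =
      if n = α * i - j then 1 else 0 := by
  have e1 : i • (α : ℤ) + j • (-1 : ℤ) = α * i - j := by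
    simp only [nsmul_eq_mul]
    ring
  have e : ξ ^ i * HahnSeries.single (-1 : ℤ) (1 : k) ^ j =
      HahnSeries.single ((α : ℤ) * i - j) 1 * HahnSeries.ofPowerSeries ℤ k (η ^ i) := by
    rw [h, mul_pow, mul_right_comm, HahnSeries.single_pow, HahnSeries.single_pow,
      HahnSeries.single_mul_single, map_pow, e1, one_pow, one_pow, one_mul]
  rw [e]
  have h1 := HahnSeries.coeff_single_mul (r := (1 : k))
    (x := HahnSeries.ofPowerSeries ℤ k (η ^ i)) (a := n) (b := (α : ℤ) * i - j)
  rw [h1, one_mul, PowerSeries.coeff_coe]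
  split_ifs with h2 h3 h3
  · omega
  · rfl
  · rw [h3]; simp [hη]
  · omega

lemma coeff_evalAtInfinity {k : Type*} [Field k] (ξ : LaurentSeries k)
    (f : Polynomial (Polynomial k)) (n : ℤ) :
    (evalAtInfinity ξ f).coeff n = ∑ i ∈ f.support, ∑ j ∈ (f.coeff i).support,
      (f.coeff i).coeff j * (ξ ^ i * HahnSeries.single (-1 : ℤ) (1 : k) ^ j).coeff n := by
  rw [evalAtInfinity, Polynomial.coe_eval₂RingHom, Polynomial.eval₂_eq_sum, Polynomial.sum,
    HahnSeries.coeff_sum]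
  refine Finset.sum_congr rfl fun i _ => ?_
  rw [Polynomial.coe_eval₂RingHom, Polynomial.eval₂_eq_sum, Polynomial.sum, Finset.sum_mul,
    HahnSeries.coeff_sum]
  refine Finset.sum_congr rfl fun j _ => ?_
  rw [mul_assoc, mul_comm (_ ^ j), HahnSeries.C_mul_eq_smul, HahnSeries.coeff_smul, smul_eq_mul]

/-- The leading exponents `j - α i` of `ξ ^ i y ^ j` are pairwise distinct over the monomials
`x ^ i y ^ j` of weighted degree at most `m α`, so that no cancellation can occur. -/
lemma eq_zero_of_le_orderTop_evalAtInfinity {k : Type*} [Field k] {m α : ℕ} (hm : 2 ≤ m)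
    {ξ : LaurentSeries k} {η : PowerSeries k}
    (h : ξ = HahnSeries.single (α : ℤ) 1 * HahnSeries.ofPowerSeries ℤ k η)
    (hη : PowerSeries.constantCoeff η = 1) {q : Polynomial (Polynomial k)}
    (hq : ∀ i j : ℕ, (q.coeff i).coeff j ≠ 0 → (α + 1) * i + m * j ≤ m * α)
    (hord : ((α * m + 1 : ℤ) : WithTop ℤ) ≤ (evalAtInfinity ξ q).orderTop) : q = 0 := by
  by_contra hq0
  obtain ⟨i₁, hi₁⟩ := Polynomial.support_nonempty.2 hq0
  obtain ⟨j₁, hj₁⟩ := Polynomial.support_nonempty.2 (Polynomial.mem_support_iff.1 hi₁)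
  let S : Finset (Σ _ : ℕ, ℕ) := q.support.sigma fun i => (q.coeff i).support
  have hS : ∀ s : Σ _ : ℕ, ℕ, s ∈ S ↔ (q.coeff s.1).coeff s.2 ≠ 0 := by
    intro s
    simp only [S, Finset.mem_sigma, Polynomial.mem_support_iff]
    exact ⟨fun h => h.2, fun h => ⟨fun h' => h (by rw [h', Polynomial.coeff_zero]), h⟩⟩
  obtain ⟨s₀, hs₀, hmin⟩ := S.exists_min_image (fun s => (α : ℤ) * s.1 - s.2)
    ⟨⟨i₁, j₁⟩, Finset.mem_sigma.2 ⟨hi₁, hj₁⟩⟩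
  have hcoef : (evalAtInfinity ξ q).coeff (α * s₀.1 - s₀.2) = (q.coeff s₀.1).coeff s₀.2 := by
    rw [coeff_evalAtInfinity, ← Finset.sum_sigma q.support (fun i => (q.coeff i).support)
      fun s => (q.coeff s.1).coeff s.2 *
        (ξ ^ s.1 * HahnSeries.single (-1 : ℤ) (1 : k) ^ s.2).coeff (α * s₀.1 - s₀.2)]
    rw [Finset.sum_eq_single s₀]
    · rw [coeff_pow_mul_pow h hη _ _ _ le_rfl, if_pos rfl, mul_one]
    · intro s hs hne
      rw [coeff_pow_mul_pow h hη _ _ _ (hmin s hs), if_neg, mul_zero]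
      intro heq
      apply hne
      obtain ⟨i, j⟩ := s
      obtain ⟨i₀, j₀⟩ := s₀
      have b := hq i j ((hS _).1 hs)
      have b₀ := hq i₀ j₀ ((hS _).1 hs₀)
      simp only at heq b b₀
      -- a monomial with `j = α` has `i = 0`, which separates `(i, 0)` from `(i + 1, α)`
      have c : j ≤ α := by nlinarith
      have c₀ : j₀ ≤ α := by nlinarith
      have d : j = α → i = 0 := by rintro rfl; nlinarith
      have d₀ : j₀ = α → i₀ = 0 := by rintro rfl; nlinarith
      have hi : i = i₀ := by
        rcases lt_trichotomy i i₀ with hlt | hlt | hlt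
        · exfalso
          have : (α : ℤ) * (i + 1) ≤ α * i₀ := by
            exact_mod_cast Nat.mul_le_mul_left α hlt
          have hj₀ : j₀ = α := by zify; zify at c₀; linarith
          have := d₀ hj₀
          omega
        · exact hlt
        · exfalso
          have : (α : ℤ) * (i₀ + 1) ≤ α * i := by
            exact_mod_cast Nat.mul_le_mul_left α hlt
          have hj : j = α := by zify; zify at c; linarith
          have := d hj
          omega
      subst hi
      have : j = j₀ := by omega
      rw [this]
    · intro h'; exact absurd hs₀ h'
  have b₀ := hq _ _ ((hS _).1 hs₀)
  have hle : (α : ℤ) * s₀.1 - s₀.2 < α * m + 1 := by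
    have : s₀.1 ≤ m := by nlinarith
    have := Nat.mul_le_mul_left α this
    zify at this
    linarith
  apply (hS _).1 hs₀
  rw [← hcoef]
  exact HahnSeries.coeff_eq_zero_of_lt_orderTop ((WithTop.coe_lt_coe.2 hle).trans_le hord)

lemma orderTop_trajectory {k : Type*} [Field k] {α : ℕ} {ξ : LaurentSeries k} {η : PowerSeries k}
    (h : ξ = HahnSeries.single (α : ℤ) 1 * HahnSeries.ofPowerSeries ℤ k η)
    (hη : PowerSeries.constantCoeff η = 1) : ξ.orderTop = ((α : ℤ) : WithTop ℤ) := by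
  have h1 : ∀ n : ℤ, n ≤ α → ξ.coeff n = if n = α then 1 else 0 := by
    intro n hn
    have := coeff_pow_mul_pow h hη 1 0 n (by simpa using hn)
    simpa using this
  apply le_antisymm
  · apply HahnSeries.orderTop_le_of_coeff_ne_zero
    rw [h1 _ le_rfl, if_pos rfl]
    exact one_ne_zero
  · by_contra hlt
    push Not at hlt
    have h0 : ξ ≠ 0 := by rintro rfl; simp at hlt
    rw [HahnSeries.orderTop_of_ne_zero h0] at hlt
    have h2 := WithTop.coe_lt_coe.1 hlt
    have := HahnSeries.coeff_orderTop_ne (HahnSeries.orderTop_of_ne_zero h0)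
    rw [h1 _ h2.le, if_neg h2.ne] at this
    exact this rfl

/-! ### Darboux polynomials and simplicity in the plane -/

lemma le_orderTop_of_mul_eq {k : Type*} [Field k] {N : WithTop ℤ} {l g h : LaurentSeries k}
    (hg : g ≠ 0) (he : l * g = h) (hN : N + g.orderTop ≤ h.orderTop) : N ≤ l.orderTop := by
  rw [← he, HahnSeries.orderTop_mul] at hN
  exact WithTop.le_of_add_le_add_right (by simpa using hg) hN

lemma le_orderTop_pow_mul_derivAtInfinity {k : Type*} [Field k] {m α : ℕ} {ξ : LaurentSeries k}
    (hξ : ξ.orderTop = ((α : ℤ) : WithTop ℤ)) (g : LaurentSeries k) :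
    ((α * m + 1 : ℤ) : WithTop ℤ) + g.orderTop ≤ (ξ ^ m * derivAtInfinity k g).orderTop ∧
    ((α * m + 1 : ℤ) : WithTop ℤ) + g.orderTop ≤ (derivAtInfinity k (ξ ^ m) * g).orderTop := by
  have h1 : ((α * m : ℤ) : WithTop ℤ) ≤ (ξ ^ m).orderTop := by
    refine le_trans (le_of_eq ?_) HahnSeries.orderTop_nsmul_le_orderTop_pow
    rw [hξ, ← WithTop.coe_nsmul]
    congr 1
    simp [mul_comm]
  rw [WithTop.coe_add, WithTop.coe_one, HahnSeries.orderTop_mul, HahnSeries.orderTop_mul]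
  constructor
  · rw [add_assoc, add_comm 1]
    exact add_le_add h1 (le_orderTop_derivAtInfinity g)
  · exact add_le_add_left ((add_le_add_left h1 1).trans (le_orderTop_derivAtInfinity _)) _

/-- A Darboux polynomial not vanishing on the formal trajectory at infinity is a first integral. -/
lemma cofactor_eq_zero {k : Type*} [Field k] {m α : ℕ} (hm : 2 ≤ m)
    {ξ : LaurentSeries k} {η : PowerSeries k}
    (h : ξ = HahnSeries.single (α : ℤ) 1 * HahnSeries.ofPowerSeries ℤ k η)
    (hη : PowerSeries.constantCoeff η = 1)
    (hξ : 1 - ξ * HahnSeries.single (-1 : ℤ) 1 ^ α = ξ ^ m * derivAtInfinity k ξ)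
    {f l : Polynomial (Polynomial k)} (hf : evalAtInfinity ξ f ≠ 0)
    (hl : planeDerivation k m α f = l * f) : l = 0 := by
  refine eq_zero_of_le_orderTop_evalAtInfinity hm h hη
    (fun i j => cofactor_weight_le (by rintro rfl; simp at hf) hl) ?_
  refine le_orderTop_of_mul_eq hf (h := ξ ^ m * derivAtInfinity k (evalAtInfinity ξ f)) ?_
    (le_orderTop_pow_mul_derivAtInfinity (orderTop_trajectory h hη) _).1
  rw [← map_mul, ← hl, evalAtInfinity_planeDerivation hξ]

/-- A Darboux polynomial vanishing to exactly first order on the formal trajectory at infinity has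
cofactor `- y ^ α`. -/
lemma cofactor_eq_neg {k : Type*} [Field k] {m α : ℕ} (hm : 2 ≤ m)
    {ξ : LaurentSeries k} {η : PowerSeries k}
    (h : ξ = HahnSeries.single (α : ℤ) 1 * HahnSeries.ofPowerSeries ℤ k η)
    (hη : PowerSeries.constantCoeff η = 1)
    (hξ : 1 - ξ * HahnSeries.single (-1 : ℤ) 1 ^ α = ξ ^ m * derivAtInfinity k ξ)
    {f l : Polynomial (Polynomial k)} (hf : evalAtInfinity ξ f = 0)
    (hf' : evalAtInfinity ξ (Polynomial.derivative f) ≠ 0)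
    (hl : planeDerivation k m α f = l * f) :
    l = -Polynomial.C ((Polynomial.X : Polynomial k) ^ α) := by
  rw [← add_eq_zero_iff_eq_neg]
  refine eq_zero_of_le_orderTop_evalAtInfinity hm h hη ?_ ?_
  · intro i j hij
    by_cases hlij : (l.coeff i).coeff j = 0
    · rw [Polynomial.coeff_add, Polynomial.coeff_add, hlij, zero_add, Polynomial.coeff_C] at hij
      split_ifs at hij with hi
      · rw [Polynomial.coeff_X_pow] at hij
        split_ifs at hij with hj
        · rw [hi, hj, mul_zero, zero_add]
        · exact absurd rfl hij
      · simp at hij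
    · exact cofactor_weight_le (by rintro rfl; simp at hf') hl hlij
  · have hord := orderTop_trajectory h hη
    have h1 := congrArg (fun p => evalAtInfinity ξ (Polynomial.derivative p)) hl
    have h2 := evalAtInfinity_planeDerivation hξ (Polynomial.derivative f)
    have h3 := derivAtInfinity_evalAtInfinity ξ f
    have h4 := derivAtInfinity_evalAtInfinity ξ ((Polynomial.X : Polynomial (Polynomial k)) ^ m)
    have h5 : derivY ((Polynomial.X : Polynomial (Polynomial k)) ^ m) = 0 := by
      rw [Derivation.leibniz_pow, coeffDerivation_X, smul_zero, smul_zero]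
    rw [hf, map_zero] at h3
    rw [h5, map_zero, zero_add, map_pow, evalAtInfinity_X] at h4
    simp only [planeDerivation_apply, Polynomial.derivative_mul,
      Polynomial.derivative_one, Polynomial.derivative_C,
      Polynomial.derivative_X, derivative_coeffDerivation, map_add, map_mul, map_sub, map_one,
      map_zero, hf] at h1 h2
    -- the `x`-derivative of `d f = l f`, evaluated at `ξ`, where `f` vanishes
    refine le_orderTop_of_mul_eq hf'
      (h := ξ ^ m * derivAtInfinity k (evalAtInfinity ξ (Polynomial.derivative f)) -
        derivAtInfinity k (ξ ^ m) * evalAtInfinity ξ (Polynomial.derivative f)) ?_ ?_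
    · rw [h4, map_add]
      linear_combination -h1 + h2 - evalAtInfinity ξ
        (Polynomial.derivative ((Polynomial.X : Polynomial (Polynomial k)) ^ m)) * h3
    · rw [sub_eq_add_neg]
      refine le_trans (le_min ?_ ?_) HahnSeries.min_orderTop_le_orderTop_add
      · exact (le_orderTop_pow_mul_derivAtInfinity hord _).1
      · rw [HahnSeries.orderTop_neg]
        exact (le_orderTop_pow_mul_derivAtInfinity hord _).2

/-- A primitive polynomial dividing a nonzero constant multiple of `p` divides `p`. -/
lemma dvd_of_isPrimitive_of_dvd_C_mul {k : Type*} [Field k] {f p : Polynomial (Polynomial k)}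
    (hf : f.IsPrimitive) {b : Polynomial k} (hb : b ≠ 0) (h : f ∣ Polynomial.C b * p) : f ∣ p := by
  refine hf.dvd_of_fraction_map_dvd_fraction_map (K := FractionRing (Polynomial k)) ?_
  have h1 := Polynomial.map_dvd (algebraMap (Polynomial k) (FractionRing (Polynomial k))) h
  rw [Polynomial.map_mul, Polynomial.map_C] at h1
  refine (IsUnit.dvd_mul_left ?_).1 h1
  rw [Polynomial.isUnit_C, isUnit_iff_ne_zero]
  simpa using hb

/-- An element of least `x`-degree in an ideal divides every other one up to a factor in `k[y]`. -/
lemma exists_dvd_C_mul_of_minimal {k : Type*} [Field k] {I : Ideal (Polynomial (Polynomial k))}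
    {g : Polynomial (Polynomial k)} (hg : g ∈ I) (hg0 : g ≠ 0)
    (hmin : ∀ p ∈ I, p ≠ 0 → g.natDegree ≤ p.natDegree) (n : ℕ) :
    ∀ p ∈ I, p.degree < n → ∃ c : Polynomial k, c ≠ 0 ∧ g ∣ Polynomial.C c * p := by
  induction n with
  | zero =>
    intro p _ hp
    have hp0 : p = 0 := by
      by_contra h
      rw [Polynomial.degree_eq_natDegree h, Nat.cast_lt] at hp
      omega
    exact ⟨1, one_ne_zero, by simp [hp0]⟩
  | succ n ih =>
    intro p hp hdeg
    by_cases hp0 : p = 0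
    · exact ⟨1, one_ne_zero, by simp [hp0]⟩
    have hlg : g.leadingCoeff ≠ 0 := by simpa using hg0
    have hlp : p.leadingCoeff ≠ 0 := by simpa using hp0
    have hle := hmin p hp hp0
    set p' := Polynomial.C g.leadingCoeff * p -
      Polynomial.C p.leadingCoeff * Polynomial.X ^ (p.natDegree - g.natDegree) * g with hp'
    have hmem : p' ∈ I := I.sub_mem (I.mul_mem_left _ hp) (I.mul_mem_left _ hg)
    have hdeg' : p'.degree < p.degree := by
      have e : (Polynomial.C g.leadingCoeff * p).degree = p.degree := by
        rw [Polynomial.degree_mul, Polynomial.degree_C hlg, zero_add]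
      rw [← e]
      apply Polynomial.degree_sub_lt_left
      · rw [e, Polynomial.degree_mul, Polynomial.degree_mul, Polynomial.degree_C hlp, zero_add,
          Polynomial.degree_X_pow, Polynomial.degree_eq_natDegree hp0,
          Polynomial.degree_eq_natDegree hg0, ← Nat.cast_add, Nat.sub_add_cancel hle]
      · exact mul_ne_zero (by simpa using hg0) hp0
      · simp only [Polynomial.leadingCoeff_mul, Polynomial.leadingCoeff_C,
          Polynomial.leadingCoeff_X_pow, mul_one]
        exact mul_comm _ _
    obtain ⟨c, hc, hdvd⟩ := ih p' hmem
      (hdeg'.trans_le (by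
        rw [Polynomial.degree_eq_natDegree hp0, Nat.cast_lt] at hdeg
        rw [Polynomial.degree_eq_natDegree hp0, Nat.cast_le]
        omega))
    refine ⟨c * g.leadingCoeff, mul_ne_zero hc hlg, ?_⟩
    have e : Polynomial.C (c * g.leadingCoeff) * p = Polynomial.C c * p' +
        Polynomial.C c * (Polynomial.C p.leadingCoeff *
          Polynomial.X ^ (p.natDegree - g.natDegree)) * g := by
      rw [hp', Polynomial.C_mul]; ring
    rw [e]
    exact dvd_add hdvd (dvd_mul_left _ _)

/-- An invariant ideal meeting `k[y]` trivially yields a Darboux polynomial. -/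
lemma exists_darboux_of_invariant {k : Type*} [Field k] {m α : ℕ}
    {I : Ideal (Polynomial (Polynomial k))} (hI0 : I ≠ ⊥)
    (hI : ∀ f ∈ I, planeDerivation k m α f ∈ I)
    (hIC : ∀ r : Polynomial k, Polynomial.C r ∈ I → r = 0) :
    ∃ (f : Polynomial (Polynomial k)) (a : Polynomial k), a ≠ 0 ∧ Polynomial.C a * f ∈ I ∧
      1 ≤ f.natDegree ∧ f ∣ planeDerivation k m α f ∧
      ∀ p ∈ I, p ≠ 0 → f.natDegree ≤ p.natDegree := by
  classical
  let : NormalizedGCDMonoid (Polynomial k) := Classical.arbitrary _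
  obtain ⟨g₁, hg₁, hg₁0⟩ := Submodule.exists_mem_ne_zero_of_ne_bot hI0
  obtain ⟨g, ⟨hg, hg0⟩, hmin⟩ := WellFounded.has_min
    (measure (Polynomial.natDegree (R := Polynomial k))).wf
    {g | g ∈ I ∧ g ≠ 0} ⟨g₁, hg₁, hg₁0⟩
  replace hmin : ∀ p ∈ I, p ≠ 0 → g.natDegree ≤ p.natDegree :=
    fun p hp hp0 => not_lt.1 (hmin p ⟨hp, hp0⟩)
  have hfac := g.eq_C_content_mul_primPart
  have ha : g.content ≠ 0 := by simpa [Polynomial.content_eq_zero_iff] using hg0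
  refine ⟨g.primPart, g.content, ha, by rwa [← hfac], ?_, ?_, ?_⟩
  · rw [g.natDegree_primPart, Nat.one_le_iff_ne_zero]
    intro h0
    rw [Polynomial.eq_C_of_natDegree_eq_zero h0] at hg hg0
    exact hg0 (by rw [hIC _ hg, Polynomial.C_0])
  · obtain ⟨c, hc, hdvd⟩ := exists_dvd_C_mul_of_minimal hg hg0 hmin
      ((planeDerivation k m α g).natDegree + 1) _ (hI g hg)
      (Polynomial.degree_le_natDegree.trans_lt (Nat.cast_lt.2 (Nat.lt_succ_self _)))
    refine dvd_of_isPrimitive_of_dvd_C_mul g.isPrimitive_primPart (mul_ne_zero hc ha) ?_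
    have h1 : g.primPart ∣ Polynomial.C c * planeDerivation k m α g :=
      g.primPart_dvd.trans hdvd
    have h2 : planeDerivation k m α g =
        Polynomial.C g.content * planeDerivation k m α g.primPart +
        g.primPart * planeDerivation k m α (Polynomial.C g.content) := by
      conv_lhs => rw [hfac]
      rw [Derivation.leibniz, smul_eq_mul, smul_eq_mul]
    rw [h2, mul_add, ← mul_assoc, ← Polynomial.C_mul] at h1
    exact (dvd_add_left ((dvd_mul_right _ _).mul_left _)).1 h1
  · rwa [g.natDegree_primPart]

lemma evalAtInfinity_C_injective {k : Type*} [Field k] [CharZero k] (ξ : LaurentSeries k) (n : ℕ) :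
    ∀ r : Polynomial k, r.natDegree ≤ n → evalAtInfinity ξ (Polynomial.C r) = 0 → r = 0 := by
  have h0 : ∀ r : Polynomial k, r.natDegree = 0 → evalAtInfinity ξ (Polynomial.C r) = 0 →
      r = 0 := by
    intro r hr h
    rw [Polynomial.eq_C_of_natDegree_eq_zero hr, evalAtInfinity_C_C] at h
    rw [Polynomial.eq_C_of_natDegree_eq_zero hr, (map_eq_zero _).1 h, Polynomial.C_0]
  induction n with
  | zero => intro r hr h; exact h0 r (by omega) h
  | succ n ih =>
    intro r hr h
    have h1 := derivAtInfinity_evalAtInfinity ξ (Polynomial.C r)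
    rw [h, coeffDerivation_C, Polynomial.derivative_C, map_zero, map_zero, zero_mul,
      add_zero] at h1
    have h2 : Polynomial.derivative r = 0 := by
      refine ih _ ?_ h1.symm
      have := Polynomial.natDegree_derivative_le r
      omega
    exact h0 r (Polynomial.derivative_eq_zero.1 h2) h

/-- The formal trajectory at infinity is transcendental over `k(y)`: a polynomial of least
`x`-degree vanishing on it would be a Darboux polynomial that vanishes to first order on it, hence
one with cofactor `- y ^ α`. -/
lemma evalAtInfinity_injective {k : Type*} [Field k] [CharZero k] {m α : ℕ}
    (hm : 2 ≤ m) (hα : 1 ≤ α) {ξ : LaurentSeries k} {η : PowerSeries k}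
    (h : ξ = HahnSeries.single (α : ℤ) 1 * HahnSeries.ofPowerSeries ℤ k η)
    (hη : PowerSeries.constantCoeff η = 1)
    (hξ : 1 - ξ * HahnSeries.single (-1 : ℤ) 1 ^ α = ξ ^ m * derivAtInfinity k ξ) :
    RingHom.ker (evalAtInfinity ξ) = ⊥ := by
  by_contra hker
  obtain ⟨f, a, ha, haf, hdeg, ⟨l, hl⟩, hmin⟩ := exists_darboux_of_invariant (m := m) (α := α) hker
    (fun f hf => by
      rw [RingHom.mem_ker] at hf ⊢
      rw [evalAtInfinity_planeDerivation hξ, hf, map_zero, mul_zero])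
    (fun r hr => evalAtInfinity_C_injective ξ _ r le_rfl hr)
  have hf : evalAtInfinity ξ f = 0 := by
    rw [RingHom.mem_ker, map_mul] at haf
    exact (mul_eq_zero.1 haf).resolve_left fun h =>
      ha (evalAtInfinity_C_injective ξ _ a le_rfl h)
  have hf' : evalAtInfinity ξ (Polynomial.derivative f) ≠ 0 := by
    intro h'
    have h0 : Polynomial.derivative f ≠ 0 := fun h0 => by
      have := Polynomial.derivative_eq_zero.1 h0
      omega
    have := hmin _ h' h0
    have := Polynomial.natDegree_derivative_lt (p := f) (by omega)
    omega
  rw [mul_comm] at hl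
  have hl' := cofactor_eq_neg hm h hη hξ hf hf' hl
  replace hl : planeDerivation k m α f = -(Polynomial.C (Polynomial.X ^ α) * f) := by
    rw [hl, hl']
    ring
  rw [eq_zero_of_planeDerivation_eq_neg hm hα hl] at hdeg
  simp at hdeg

/-- Since `d (x ^ (N + 1)) ≡ (N + 1) x ^ N` modulo `x ^ (N + 1)`, powers of `x` can be lowered. -/
lemma one_mem_of_X_pow_mem {k : Type*} [Field k] [CharZero k] {m α : ℕ}
    {I : Ideal (Polynomial (Polynomial k))} (hI : ∀ f ∈ I, planeDerivation k m α f ∈ I) (N : ℕ) :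
    Polynomial.X ^ N ∈ I → (1 : Polynomial (Polynomial k)) ∈ I := by
  induction N with
  | zero => intro h; simpa using h
  | succ N ih =>
    intro h
    apply ih
    have h1 := hI _ h
    have hy : derivY ((Polynomial.X : Polynomial (Polynomial k)) ^ (N + 1)) = 0 := by
      rw [Derivation.leibniz_pow, coeffDerivation_X, smul_zero, smul_zero]
    rw [planeDerivation_apply, hy, mul_zero, zero_add, Polynomial.derivative_X_pow_succ] at h1
    have h2 := I.mul_mem_left (Polynomial.C (Polynomial.C ((N + 1 : k)⁻¹)))
      (I.add_mem h1 (I.mul_mem_left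
        (((N : Polynomial (Polynomial k)) + 1) * Polynomial.C (Polynomial.X ^ α)) h))
    have hc : Polynomial.C (Polynomial.C ((N + 1 : k)⁻¹)) * ((N : Polynomial (Polynomial k)) + 1)
        = 1 := by
      have e : ((N : Polynomial (Polynomial k)) + 1) =
          Polynomial.C (Polynomial.C ((N : k) + 1)) := by simp
      rw [e, ← Polynomial.C_mul, ← Polynomial.C_mul, inv_mul_cancel₀ (Nat.cast_add_one_ne_zero N)]
      simp
    convert h2 using 1
    simp only [map_add, map_natCast, map_one]
    linear_combination -(Polynomial.X : Polynomial (Polynomial k)) ^ N * hc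

/-- Since `d r = x ^ m r'` for `r ∈ k[y]`, an invariant ideal that contains `x ^ N r` also contains
`x ^ (N + m + 1) r'`; differentiating `r` down to a constant leaves a power of `x`. -/
lemma one_mem_of_X_pow_mul_C_mem {k : Type*} [Field k] [CharZero k] {m α : ℕ}
    {I : Ideal (Polynomial (Polynomial k))} (hI : ∀ f ∈ I, planeDerivation k m α f ∈ I) (n : ℕ) :
    ∀ (r : Polynomial k) (N : ℕ), r ≠ 0 → r.natDegree ≤ n →
      Polynomial.X ^ N * Polynomial.C r ∈ I → (1 : Polynomial (Polynomial k)) ∈ I := by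
  have h0 : ∀ (r : Polynomial k) (N : ℕ), r ≠ 0 → r.natDegree = 0 →
      Polynomial.X ^ N * Polynomial.C r ∈ I → (1 : Polynomial (Polynomial k)) ∈ I := by
    intro r N hr hdeg hmem
    refine one_mem_of_X_pow_mem hI N ?_
    rw [Polynomial.eq_C_of_natDegree_eq_zero hdeg] at hr hmem
    have hr' : r.coeff 0 ≠ 0 := by simpa using hr
    have := I.mul_mem_right (Polynomial.C (Polynomial.C (r.coeff 0)⁻¹)) hmem
    rwa [mul_assoc, ← Polynomial.C_mul, ← Polynomial.C_mul, mul_inv_cancel₀ hr', Polynomial.C_1,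
      Polynomial.C_1, mul_one] at this
  induction n with
  | zero => intro r N hr hdeg; exact h0 r N hr (by omega)
  | succ n ih =>
    intro r N hr hdeg hmem
    by_cases hr' : Polynomial.derivative r = 0
    · exact h0 r N hr (Polynomial.derivative_eq_zero.1 hr') hmem
    refine ih (Polynomial.derivative r) (N + m + 1) hr' ?_ ?_
    · have := Polynomial.natDegree_derivative_le r
      omega
    · have h1 := I.sub_mem (I.mul_mem_left Polynomial.X (hI _ hmem))
        (I.mul_mem_left ((N : Polynomial (Polynomial k)) *
          (1 - Polynomial.X * Polynomial.C (Polynomial.X ^ α))) hmem)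
      convert h1 using 1
      have hC : planeDerivation k m α (Polynomial.C r) =
          Polynomial.X ^ m * Polynomial.C (Polynomial.derivative r) := by
        rw [planeDerivation_apply, coeffDerivation_C, Polynomial.derivative_C, mul_zero, add_zero]
        rfl
      have hX : planeDerivation k m α Polynomial.X =
          1 - Polynomial.X * Polynomial.C (Polynomial.X ^ α) := by
        rw [planeDerivation_apply, coeffDerivation_X, Polynomial.derivative_X]
        ring
      rw [Derivation.leibniz, Derivation.leibniz_pow, hC, hX]
      simp only [smul_eq_mul, nsmul_eq_mul]
      rcases N with _ | N
      · simp; ring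
      · rw [Nat.add_sub_cancel]; ring

lemma isSimpleDerivation_planeDerivation (k : Type*) [Field k] [CharZero k] {m α : ℕ}
    (hm : 2 ≤ m) (hα : 1 ≤ α) : IsSimpleDerivation (planeDerivation k m α) := by
  rintro ⟨I, hI0, hI1, hI⟩
  by_cases hIC : ∀ r : Polynomial k, Polynomial.C r ∈ I → r = 0
  · obtain ⟨ξ, η, h, hη, hξ⟩ := exists_formal_trajectory k m α
    obtain ⟨f, a, -, -, hdeg, ⟨l, hl⟩, -⟩ := exists_darboux_of_invariant hI0 hI hIC
    have hf : evalAtInfinity ξ f ≠ 0 := by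
      intro h'
      rw [← RingHom.mem_ker, evalAtInfinity_injective hm hα h hη hξ, Ideal.mem_bot] at h'
      rw [h'] at hdeg
      simp at hdeg
    rw [mul_comm] at hl
    rw [cofactor_eq_zero hm h hη hξ hf hl, zero_mul] at hl
    obtain ⟨c, rfl⟩ := eq_const_of_planeDerivation_eq_C (g := 0) hm hα (by rw [hl, Polynomial.C_0])
    simp at hdeg
  · push Not at hIC
    obtain ⟨r, hr, hr0⟩ := hIC
    exact hI1 ((Ideal.eq_top_iff_one I).2
      (one_mem_of_X_pow_mul_C_mem hI _ r 0 hr0 le_rfl (by simpa using hr)))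

/-! ### Adjoining variables -/

/-- The properties of a derivation `d` and an element `t` that pass from `(d, t)` to the extension
of `d` to `R[X]` with `X ↦ t`, paired with the new element `X`: simplicity, absence of nontrivial
preimages in the span of `1` and `t`, and triviality of the constants. -/
structure IsExtensible {k R : Type*} [Field k] [CommRing R] [Algebra k R]
    (d : Derivation k R R) (t : R) : Prop where
  simple : IsSimpleDerivation d
  eq_zero : ∀ (r : R) (a b : k), d r = algebraMap k R a + algebraMap k R b * t → a = 0 ∧ b = 0
  const : ∀ r : R, d r = 0 → ∃ c : k, r = algebraMap k R c

lemma coeff_polyDerivation_one {k R : Type*} [CommRing k] [CommRing R] [Algebra k R]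
    (d : Derivation k R R) (t : R) (f : Polynomial R) (i : ℕ) :
    (polyDerivation 1 d (Polynomial.C t) f).coeff i =
      d (f.coeff i) + t * (f.coeff (i + 1) * (i + 1)) := by
  rw [polyDerivation_apply, one_mul, Polynomial.coeff_add, coeff_coeffDerivation,
    Polynomial.coeff_C_mul, Polynomial.coeff_derivative]

/-- Shamsuddin's criterion: the extension of a simple derivation with `X ↦ t` is simple when no
nonzero multiple of `t` is in the image. -/
lemma isSimpleDerivation_polyDerivation {k R : Type*} [Field k] [CharZero k] [CommRing R]
    [Algebra k R] {d : Derivation k R R} {t : R} (h : IsExtensible d t) :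
    IsSimpleDerivation (polyDerivation 1 d (Polynomial.C t)) := by
  rintro ⟨I, hI0, hI1, hI⟩
  obtain ⟨g₁, hg₁, hg₁0⟩ := Submodule.exists_mem_ne_zero_of_ne_bot hI0
  obtain ⟨g, ⟨hg, hg0⟩, hmin⟩ := WellFounded.has_min
    (measure (Polynomial.natDegree (R := R))).wf {g | g ∈ I ∧ g ≠ 0} ⟨g₁, hg₁, hg₁0⟩
  replace hmin : ∀ p ∈ I, p ≠ 0 → g.natDegree ≤ p.natDegree :=
    fun p hp hp0 => not_lt.1 (hmin p ⟨hp, hp0⟩)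
  set n := g.natDegree
  -- the leading coefficients of the elements of least degree form an invariant ideal
  let J : Ideal R :=
    { carrier := {r | ∃ f ∈ I, f.natDegree ≤ n ∧ f.coeff n = r}
      add_mem' := by
        rintro _ _ ⟨f, hf, hfn, rfl⟩ ⟨f', hf', hfn', rfl⟩
        exact ⟨f + f', I.add_mem hf hf', Polynomial.natDegree_add_le_of_degree_le hfn hfn',
          Polynomial.coeff_add _ _ _⟩
      zero_mem' := ⟨0, I.zero_mem, by simp, by simp⟩
      smul_mem' := by
        rintro c _ ⟨f, hf, hfn, rfl⟩
        exact ⟨Polynomial.C c * f, I.mul_mem_left _ hf,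
          (Polynomial.natDegree_C_mul_le _ _).trans hfn, by simp⟩ }
  have hJ : ∀ r ∈ J, d r ∈ J := by
    rintro _ ⟨f, hf, hfn, rfl⟩
    refine ⟨_, hI f hf, ?_, ?_⟩
    · rw [Polynomial.natDegree_le_iff_coeff_eq_zero]
      intro i hi
      rw [coeff_polyDerivation_one, Polynomial.coeff_eq_zero_of_natDegree_lt (by omega),
        Polynomial.coeff_eq_zero_of_natDegree_lt (by omega)]
      simp
    · rw [coeff_polyDerivation_one,
        Polynomial.coeff_eq_zero_of_natDegree_lt (n := n + 1) (by omega)]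
      simp
  have hJ0 : J ≠ ⊥ := by
    intro h0
    have : g.leadingCoeff ∈ J := ⟨g, hg, le_rfl, rfl⟩
    rw [h0, Ideal.mem_bot, Polynomial.leadingCoeff_eq_zero] at this
    exact hg0 this
  have hJ1 : J = ⊤ := by
    by_contra h1
    exact h.simple ⟨J, hJ0, h1, hJ⟩
  obtain ⟨f, hf, hfn, hf1⟩ : (1 : R) ∈ J := hJ1 ▸ Submodule.mem_top
  rcases hn : n with _ | N
  · rw [hn] at hfn hf1
    rw [Polynomial.eq_C_of_natDegree_le_zero hfn, hf1, Polynomial.C_1] at hf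
    exact hI1 ((Ideal.eq_top_iff_one I).2 hf)
  -- a monic element of least degree is killed by the derivation, and its second coefficient then
  -- yields a preimage of a nonzero multiple of `t`
  · rw [hn] at hfn hf1
    have hdeg : (polyDerivation 1 d (Polynomial.C t) f).natDegree ≤ N := by
      rw [Polynomial.natDegree_le_iff_coeff_eq_zero]
      intro i hi
      rw [coeff_polyDerivation_one,
        Polynomial.coeff_eq_zero_of_natDegree_lt (n := i + 1) (by omega)]
      rcases (show i = N + 1 ∨ N + 1 < i by omega) with rfl | hi'
      · rw [hf1]; simp
      · rw [Polynomial.coeff_eq_zero_of_natDegree_lt (by omega)]; simp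
    have h0 : polyDerivation 1 d (Polynomial.C t) f = 0 := by
      by_contra h0
      have := hmin _ (hI f hf) h0
      omega
    have h1 := coeff_polyDerivation_one d t f N
    rw [h0, hf1, Polynomial.coeff_zero] at h1
    have h2 := (h.eq_zero (f.coeff N) 0 (-(N + 1)) (by
      simp only [map_zero, map_neg, map_add, map_natCast, map_one]
      linear_combination -h1)).2
    exact Nat.cast_add_one_ne_zero N (neg_eq_zero.1 h2)

/-- If the extended derivation maps `r` into the span of `1` and `X`, then `r` is constant. -/
lemma eq_C_of_polyDerivation_eq {k R : Type*} [Field k] [CharZero k] [CommRing R]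
    [Algebra k R] {d : Derivation k R R} {t : R} (h : IsExtensible d t) {r : Polynomial R} {a b : k}
    (hr : polyDerivation 1 d (Polynomial.C t) r = algebraMap k (Polynomial R) a +
      algebraMap k (Polynomial R) b * Polynomial.X) :
    r = Polynomial.C (r.coeff 0) ∧ d (r.coeff 0) = algebraMap k R a ∧ b = 0 := by
  have hc : ∀ i, d (r.coeff i) + t * (r.coeff (i + 1) * (i + 1)) =
      if i = 0 then algebraMap k R a else if i = 1 then algebraMap k R b else 0 := by
    intro i
    rw [← coeff_polyDerivation_one, hr, Polynomial.algebraMap_apply, Polynomial.algebraMap_apply,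
      Polynomial.coeff_add, Polynomial.coeff_C, Polynomial.coeff_C_mul, Polynomial.coeff_X]
    rcases i with _ | _ | i <;> simp
  have hdeg : r.natDegree ≤ 1 := by
    by_contra hlt
    obtain ⟨s, hs⟩ : ∃ s, r.natDegree = s + 2 := ⟨r.natDegree - 2, by omega⟩
    have h1 := hc (s + 2)
    rw [Polynomial.coeff_eq_zero_of_natDegree_lt (n := s + 2 + 1) (by omega)] at h1
    obtain ⟨c, hcc⟩ := h.const (r.coeff (s + 2)) (by simpa using h1)
    have h2 := hc (s + 1)
    rw [hcc] at h2
    have h3 := (h.eq_zero (r.coeff (s + 1)) (if s = 0 then b else 0) (-(c * (s + 2))) (by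
      simp only [map_neg, map_add, map_natCast, map_mul, map_ofNat, apply_ite (algebraMap k R),
        map_zero]
      simp only [Nat.add_eq_zero_iff, one_ne_zero, and_false, if_false, Nat.add_eq_right] at h2
      rw [← h2]
      push_cast
      ring)).2
    have h4 : (s + 2 : k) ≠ 0 := by exact_mod_cast (Nat.succ_ne_zero (s + 1))
    have h5 : c = 0 := (mul_eq_zero.1 (neg_eq_zero.1 h3)).resolve_right h4
    rw [h5, map_zero, ← hs] at hcc
    have : r = 0 := by simpa using hcc
    rw [this] at hs
    simp at hs
  have h1 := hc 1
  rw [Polynomial.coeff_eq_zero_of_natDegree_lt (n := 1 + 1) (by omega)] at h1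
  have hb : b = 0 := (h.eq_zero (r.coeff 1) b 0 (by simpa using h1)).1
  obtain ⟨c, hcc⟩ := h.const (r.coeff 1) (by simpa [hb] using h1)
  have h0 := hc 0
  rw [zero_add, hcc] at h0
  simp only [if_true, Nat.cast_zero, zero_add, mul_one] at h0
  have hc0 := (h.eq_zero (r.coeff 0) a (-c) (by
    rw [map_neg]
    linear_combination h0)).2
  rw [neg_eq_zero.1 hc0, map_zero] at hcc h0
  refine ⟨?_, by simpa using h0, hb⟩
  ext i
  rcases i with _ | _ | i
  · simp
  · rw [zero_add, hcc]; simp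
  · rw [Polynomial.coeff_eq_zero_of_natDegree_lt (by omega)]; simp

lemma IsExtensible.extend {k R : Type*} [Field k] [CharZero k] [CommRing R]
    [Algebra k R] {d : Derivation k R R} {t : R} (h : IsExtensible d t) :
    IsExtensible (polyDerivation 1 d (Polynomial.C t)) Polynomial.X where
  simple := isSimpleDerivation_polyDerivation h
  eq_zero r a b hr := by
    obtain ⟨-, h1, h2⟩ := eq_C_of_polyDerivation_eq h hr
    exact ⟨(h.eq_zero (r.coeff 0) a 0 (by simpa using h1)).1, h2⟩
  const r hr := by
    obtain ⟨h0, h1, -⟩ := eq_C_of_polyDerivation_eq (a := 0) (b := 0) h (by simpa using hr)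
    obtain ⟨c, hc⟩ := h.const _ (by simpa using h1)
    exact ⟨c, by rw [h0, hc]; rfl⟩

lemma IsExtensible.of_algEquiv {k R S : Type*} [Field k] [CommRing R] [Algebra k R] [CommRing S]
    [Algebra k S] {d : Derivation k R R} {d' : Derivation k S S} {t : R} (e : S ≃ₐ[k] R)
    (he : ∀ s, e (d' s) = d (e s)) (h : IsExtensible d t) : IsExtensible d' (e.symm t) where
  simple := by
    rintro ⟨I, hI0, hI1, hI⟩
    refine h.simple ⟨I.comap (e.symm : R →+* S), ?_, ?_, ?_⟩
    · obtain ⟨s, hs, hs0⟩ := Submodule.exists_mem_ne_zero_of_ne_bot hI0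
      intro h0
      have : e s ∈ I.comap (e.symm : R →+* S) := by
        rw [Ideal.mem_comap]
        simpa using hs
      rw [h0, Ideal.mem_bot] at this
      exact hs0 (by simpa using this)
    · intro h1
      apply hI1
      rw [Ideal.eq_top_iff_one] at h1 ⊢
      simpa [Ideal.mem_comap] using h1
    · intro r hr
      rw [Ideal.mem_comap] at hr ⊢
      have h1 : e.symm (d r) = d' (e.symm r) := by
        rw [AlgEquiv.symm_apply_eq, he, e.apply_symm_apply]
      change e.symm (d r) ∈ I
      rw [h1]
      exact hI _ hr
  eq_zero s a b hs := by
    refine h.eq_zero (e s) a b ?_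
    rw [← he, hs]
    simp
  const s hs := by
    obtain ⟨c, hc⟩ := h.const (e s) (by rw [← he, hs, map_zero])
    exact ⟨c, by rw [← e.symm_apply_apply s, hc, AlgEquiv.commutes]⟩

lemma isExtensible_planeDerivation (k : Type*) [Field k] [CharZero k] {m α : ℕ}
    (hm : 2 ≤ m) (hα : 1 ≤ α) :
    IsExtensible (planeDerivation k m α) (Polynomial.C Polynomial.X) where
  simple := isSimpleDerivation_planeDerivation k hm hα
  eq_zero r a b hr := by
    have e : algebraMap k (Polynomial (Polynomial k)) a +
        algebraMap k (Polynomial (Polynomial k)) b * Polynomial.C Polynomial.X =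
        Polynomial.C (Polynomial.C a + Polynomial.C b * Polynomial.X) := by
      rw [Polynomial.C_add, Polynomial.C_mul]; rfl
    rw [e] at hr
    obtain ⟨c, rfl⟩ := eq_const_of_planeDerivation_eq_C hm hα hr
    have h0 : planeDerivation k m α (Polynomial.C (Polynomial.C c)) = 0 :=
      Derivation.map_algebraMap _ c
    rw [h0, eq_comm, Polynomial.C_eq_zero] at hr
    have h1 := congrArg (fun p => Polynomial.coeff p 0) hr
    have h2 := congrArg (fun p => Polynomial.coeff p 1) hr
    simp at h1 h2
    exact ⟨h1, h2⟩
  const r hr := eq_const_of_planeDerivation_eq_C (g := 0) hm hα (by rw [hr, Polynomial.C_0])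

lemma dn_X {k : Type*} [Field k] {m α n : ℕ} (hn : 2 ≤ n) (i : Fin n) :
    dn k m α n hn (X i) = dnCoeff k m α n hn i := by
  have h : ∀ s : Finset (Fin n),
      (∑ i ∈ s, dnCoeff k m α n hn i • pderiv (R := k) i) (X i) =
        ∑ j ∈ s, dnCoeff k m α n hn j * pderiv j (X i) := by
    intro s
    induction s using Finset.induction_on with
    | empty => simp
    | insert a s ha ih =>
      rw [Finset.sum_insert ha, Finset.sum_insert ha, Derivation.add_apply, ih]
      rfl
  rw [dn, h, Finset.sum_eq_single i]
  · rw [pderiv_X_self, mul_one]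
  · intro j _ hj
    rw [pderiv_X_of_ne hj.symm, mul_zero]
  · intro h; exact absurd (Finset.mem_univ i) h

lemma map_derivation_of_X {k σ S : Type*} [Field k] [CommRing S] [Algebra k S]
    (e : MvPolynomial σ k →ₐ[k] S) (d : Derivation k (MvPolynomial σ k) (MvPolynomial σ k))
    (d' : Derivation k S S) (h : ∀ i, e (d (X i)) = d' (e (X i))) (p : MvPolynomial σ k) :
    e (d p) = d' (e p) := by
  induction p using MvPolynomial.induction_on with
  | C c =>
    rw [← MvPolynomial.algebraMap_eq, Derivation.map_algebraMap, AlgHom.commutes,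
      Derivation.map_algebraMap, map_zero]
  | add p q hp hq => simp only [map_add, hp, hq]
  | mul_X p i hp =>
    rw [Derivation.leibniz, map_mul, Derivation.leibniz, ← hp, ← h]
    simp only [smul_eq_mul, map_add, map_mul]

/-- The identification of `k[x₁, …, xₙ₊₁]` with `k[x₁, …, xₙ][xₙ₊₁]`. -/
noncomputable def lastVarEquiv (k : Type*) [Field k] (n : ℕ) :
    MvPolynomial (Fin (n + 1)) k ≃ₐ[k] Polynomial (MvPolynomial (Fin n) k) :=
  (renameEquiv k finSuccEquivLast).trans (optionEquivLeft k (Fin n))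

lemma lastVarEquiv_X_castSucc {k : Type*} [Field k] {n : ℕ} (i : Fin n) :
    lastVarEquiv k n (X i.castSucc) = Polynomial.C (X i) := by
  simp [lastVarEquiv]

lemma lastVarEquiv_X_last {k : Type*} [Field k] {n : ℕ} :
    lastVarEquiv k n (X (Fin.last n)) = Polynomial.X := by
  simp [lastVarEquiv]

/-- The identification of `k[x₁, x₂]` with `k[x₂][x₁]`. -/
noncomputable def planeEquiv (k : Type*) [Field k] :
    MvPolynomial (Fin 2) k ≃ₐ[k] Polynomial (Polynomial k) :=
  (finSuccEquiv k 1).trans (Polynomial.mapAlgEquiv (uniqueAlgEquiv k (Fin 1)))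

lemma planeEquiv_X_zero {k : Type*} [Field k] : planeEquiv k (X 0) = Polynomial.X := by
  rw [planeEquiv, AlgEquiv.trans_apply, finSuccEquiv_X_zero]
  simp

lemma planeEquiv_X_one {k : Type*} [Field k] :
    planeEquiv k (X 1) = Polynomial.C Polynomial.X := by
  have : (1 : Fin 2) = Fin.succ 0 := rfl
  rw [planeEquiv, AlgEquiv.trans_apply, this, finSuccEquiv_X_succ]
  simp [uniqueAlgEquiv]

/-- Adjoining the last variable is an extension with `xₙ₊₁ ↦ xₙ`, so the case of two variables
propagates. -/
lemma isExtensible_dn {k : Type*} [Field k] [CharZero k] {m α : ℕ} (hm : 2 ≤ m) (hα : 1 ≤ α)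
    (n : ℕ) (hn : 2 ≤ n) : IsExtensible (dn k m α n hn) (X ⟨n - 1, by omega⟩) := by
  induction n, hn using Nat.le_induction with
  | base =>
    have h := IsExtensible.of_algEquiv (d' := dn k m α 2 le_rfl) (planeEquiv k)
      (map_derivation_of_X (planeEquiv k).toAlgHom _ _ ?_) (isExtensible_planeDerivation k hm hα)
    · rwa [(AlgEquiv.symm_apply_eq _).2 planeEquiv_X_one.symm] at h
    · intro i
      change planeEquiv k _ = planeDerivation k m α (planeEquiv k (X i))
      rw [dn_X]
      fin_cases i
      · change planeEquiv k (1 - X 0 * X 1 ^ α) = planeDerivation k m α (planeEquiv k (X 0))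
        rw [planeEquiv_X_zero, planeDerivation_apply, coeffDerivation_X, Polynomial.derivative_X,
          mul_zero, zero_add, mul_one, map_sub, map_one, map_mul, map_pow, planeEquiv_X_zero,
          planeEquiv_X_one, Polynomial.C_pow]
      · change planeEquiv k (X 0 ^ m) = planeDerivation k m α (planeEquiv k (X 1))
        rw [planeEquiv_X_one, planeDerivation_apply, coeffDerivation_C, Polynomial.derivative_C,
          mul_zero, add_zero, map_pow, planeEquiv_X_zero]
        simp
  | succ n hn ih =>
    have h := IsExtensible.of_algEquiv (d' := dn k m α (n + 1) (by omega)) (lastVarEquiv k n)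
      (map_derivation_of_X (lastVarEquiv k n).toAlgHom _ _ ?_) ih.extend
    · rwa [(AlgEquiv.symm_apply_eq _).2 lastVarEquiv_X_last.symm] at h
    · intro i
      change lastVarEquiv k n _ = polyDerivation 1 (dn k m α n hn) _ (lastVarEquiv k n (X i))
      have h0 : lastVarEquiv k n (X ⟨0, by omega⟩) = Polynomial.C (X ⟨0, by omega⟩) :=
        lastVarEquiv_X_castSucc (⟨0, by omega⟩ : Fin n)
      have h1 : lastVarEquiv k n (X ⟨1, by omega⟩) = Polynomial.C (X ⟨1, by omega⟩) :=
        lastVarEquiv_X_castSucc (⟨1, by omega⟩ : Fin n)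
      rw [dn_X]
      induction i using Fin.lastCases with
      | last =>
        rw [lastVarEquiv_X_last, polyDerivation_apply, coeffDerivation_X, Polynomial.derivative_X,
          mul_zero, zero_add, mul_one, dnCoeff, if_neg (by simp; omega), if_neg (by simp; omega)]
        exact lastVarEquiv_X_castSucc (⟨n - 1, by omega⟩ : Fin n)
      | cast i =>
        rw [lastVarEquiv_X_castSucc, polyDerivation_apply, coeffDerivation_C,
          Polynomial.derivative_C, mul_zero, add_zero, one_mul, dn_X]
        unfold dnCoeff
        simp only [Fin.val_castSucc]
        split_ifs with hi hi'
        · simp only [map_sub, map_one, map_mul, map_pow, h0, h1]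
        · simp only [map_pow, h0]
        · exact lastVarEquiv_X_castSucc (⟨i.val - 1, by omega⟩ : Fin n)

theorem theorem3p3 {k : Type*} [Field k] [CharZero k] (m α n : ℕ)
    (hm : 2 ≤ m) (hα : 1 ≤ α) (hn : 2 ≤ n) :
    IsSimpleDerivation (dn k m α n hn) ∧
      ∀ r : MvPolynomial (Fin n) k, ¬ IsUnit (dn k m α n hn r) := by
  have h := isExtensible_dn (k := k) hm hα n hn
  refine ⟨h.simple, fun r hr => ?_⟩
  obtain ⟨c, hc, hcr⟩ := MvPolynomial.isUnit_iff_eq_C_of_isReduced.1 hr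
  refine hc.ne_zero (h.eq_zero r c 0 ?_).1
  rw [hcr, map_zero, zero_mul, add_zero]
  rfl
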